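/- **Setting.** Let $(\Omega,\mathcal F,\mathbb P)$ be a probability space, $v:\Omega\to\Xi$ a random variable with values in a measurable space, and $F:\Xi\times\mathbb R^n\to\mathbb R^n$ a measurable map with $F(v,x)$ integrable for every $x\in\mathbb R^n$; put $T(x)=\mathbb E[F(v,x)]$. Let $X=X_0\cap\bigcap_{i\in\mathcal I}X_i$, where $X_0$ and all $X_i=\{x:g_i(x)\le 0\}$ are closed convex subsets of $\mathbb R^n$ and $g_i:\mathbb R^n\to\mathbb R\cup\{\infty\}$ is convex and finite on $X_0$. Here $\mathcal I$ is a measurable space and $i\mapsto g_i(x)$ is measurable for $x\in X_0$. With $g_i^+=\max\{0,g_i\}$, assume that $\partial g_i^+(x)\neq\emptyset$ for $x\in X_0\setminus X_i$, and that $\|d\|\le C_g$ for all $x\in X_0$, $i\in\mathcal I$, $d\in\partial g_i^+(x)$, where $C_g>0$. Let $X^*$ be the set of all $x^*\in X$ with $\langle T(x^*),x-x^*\rangle\ge 0$ for all $x\in X$. **Method.** Let $\theta>0$, $\lambda>0$, $\beta\in(0,2)$, $\alpha_0=\alpha_1=\theta$ and $\alpha_k=\theta/\sqrt{k(\ln k)^{1+\lambda}}$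 for $k\ge2$. Given a deterministic $x^0\in X_0$, random controls $\omega_k\in\mathcal I$ and operator samples $v^k$, let $$y^k=\Pi_{X_0}[x^k-\alpha_kF(v^k,x^k)],\qquad x^{k+1}=\Pi_{X_0}\Big[y^k-\beta\,\frac{g^+_{\omega_k}(y^k)}{\|d^k\|^2}\,d^k\Big],$$ where $d^k\in\partial g^+_{\omega_k}(y^k)\setminus\{0\}$ if $g^+_{\omega_k}(y^k)>0$ (if $g^+_{\omega_k}(y^k)=0$, the bracket is $y^k$). Put $\mathcal F_k=\sigma(\omega_0,\dots,\omega_{k-1},v^0,\dots,v^{k-1})$; $d^k$ is chosen $\mathcal F_{k+1}$-measurable. Let $\widehat x^k=\sum_{i=0}^k\alpha_ix^i\big/\sum_{i=0}^k\alpha_i$. **Assumptions.** $X^*\ne\emptyset$; $\langle T(y)-T(x),y-x\rangle\ge0$ for all $x,y\in\mathbb R^n$; each $v^k$ has the distribution of $v$ and is independent of $\mathcal F_k$; there is $c>0$ such that for all $x\in X_0$ and $k\ge0$, a.s., $\mathrm{dist}(x,X)^2\le c\,\mathbb E[g^+_{\omega_k}(x)^2\mid\mathcal F_k]$; there is $\rho>0$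 such that $\langle T(x^*),x-x^*\rangle\ge\rho\,\mathrm{dist}(x,X^*)$ for all $x^*\in X^*$, $x\in X$; and $T$ is $(L,\delta)$-Hölder continuous, $\|T(x)-T(y)\|\le L\|x-y\|^\delta$, with $L\ge0$ and $\delta\in(0,1]$. Fix $\tau>1$ and such $c,C_g,\rho$, and put $$\mathsf G_\tau=\frac{c\,C_g^2\,\tau}{\tau-1},\quad \mathsf H_\tau=2(1+\tau),\quad B(x)=\sqrt{\mathbb E\|F(v,x)\|^2},\quad s=2+\frac1{2(\ln2)^{1+\lambda}}+\frac1{\lambda(\ln2)^\lambda}.$$ Suppose that one of the following holds. 1. (Unbounded case.) $\delta=1$; $\mathbb E\|F(v,x)\|^2<\infty$ for all $x$; and there is a measurable $\ell:\Xi\to[0,\infty)$ with $\mathbb E[\ell(v)^2]<\infty$ such that a.s. $\|F(v,y)-F(v,x)\|\le\ell(v)\|y-x\|$ for all $x,y$. Let $L_F=\sqrt{\mathbb E[\ell(v)^2]}$ (one may take $L=L_F$), let $\phi\in(0,1)$, and let $k_0\ge2$ be the least natural number with $k_0\ge\exp\Big[\Big(\frac{2(1+\tau)L_F^2\theta^2}{\lambda\beta(2-\beta)\phi}\Big)^{1/\lambda}\Big]+1$.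 For $x^*\in X^*$ put $$\mathsf I(x^*)=\frac{\max_{0\le k\le k_0}\mathbb E\|x^k-x^*\|^2+\big[\mathsf G_\tau\mathsf H_\tau^{-1}(\rho+B(x^*))^2L_F^{-2}+B(x^*)^2L_F^{-2}\big]\phi}{1-\phi},$$ $$\mathsf J(x^*)=\big[\mathsf I(x^*)L_F^2+B(x^*)^2\big]\mathsf H_\tau+\frac{\mathsf G_\tau(\rho+B(x^*))^2}{\beta(2-\beta)},\qquad \mathsf V=\frac{\max\{\theta,\theta^{-1}\}}2\inf_{x^*\in X^*}\big\{\|x^0-x^*\|^2+\mathsf J(x^*)\,s\big\},$$ where $L_F^{-2}$ is read as $0$ if $L_F=0$. 2. (Bounded case.) There is $C_F>0$ with $\sup_{x\in X_0}\mathbb E\|F(v,x)\|^2\le2C_F^2$. Put $$\widehat{\mathsf J}=\mathsf H_\tau C_F^2+\frac{\mathsf G_\tau(\rho+\sqrt2\,C_F)^2}{\beta(2-\beta)},\qquad \mathsf V=\frac{\max\{\theta,\theta^{-1}\}}2\big\{\mathrm{dist}(x^0,X^*)^2+\widehat{\mathsf J}\,s\big\}.$$ **Conclusion.** In each case $\mathsf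 V>0$, and for all $k\ge2$ with $k(\ln k)^{1+\lambda}\ge1$ (which holds for every $k\ge3$) and $$\frac{k}{(\ln k)^{1+\lambda}}>\Big(\frac{\mathsf V\,L^{1/\delta}}{\rho^{1+1/\delta}}\Big)^2,$$ one has $$\operatorname*{argmin}_{x\in X}\big\langle\mathbb E[F(v,\widehat x^k)],x\big\rangle\subset X^*,$$ where in $\mathbb E[F(v,\widehat x^k)]$ (which exists) $v$ stands for any random variable on $\Omega$ with the distribution of $v$ that is independent of $\mathcal F_k$, for instance $v^k$. -/

import Mathlib

open MeasureTheory ProbabilityTheory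
open scoped NNReal

noncomputable section

namespace SVI

/-- The solution set of the variational inequality `VI(T, X)`. -/
def solutionSet {n : ℕ} (T : EuclideanSpace ℝ (Fin n) → EuclideanSpace ℝ (Fin n))
    (X : Set (EuclideanSpace ℝ (Fin n))) : Set (EuclideanSpace ℝ (Fin n)) :=
  {z | z ∈ X ∧ ∀ y ∈ X, 0 ≤ inner ℝ (T z) (y - z)}

/-- The set of minimizers over `X` of the linear function `x ↦ ⟨p, x⟩`. -/
def linearArgmin {n : ℕ} (p : EuclideanSpace ℝ (Fin n))
    (X : Set (EuclideanSpace ℝ (Fin n))) : Set (EuclideanSpace ℝ (Fin n)) :=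
  {z | z ∈ X ∧ IsMinOn (fun x => inner ℝ p x) X z}

/-- `p` is the orthogonal projection of `x` onto `C`
(for a nonempty closed convex `C` there is exactly one such `p`). -/
def IsProjection {n : ℕ} (C : Set (EuclideanSpace ℝ (Fin n)))
    (x p : EuclideanSpace ℝ (Fin n)) : Prop :=
  p ∈ C ∧ ∀ z ∈ C, ‖x - p‖ ≤ ‖x - z‖

/-- The subdifferential at `x` of the extended-valued function that equals `h` on its effective
domain `D` and `+∞` outside `D`. -/
def subdifferential {n : ℕ} (D : Set (EuclideanSpace ℝ (Fin n)))
    (h : EuclideanSpace ℝ (Fin n) → ℝ) (x : EuclideanSpace ℝ (Fin n)) :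
    Set (EuclideanSpace ℝ (Fin n)) :=
  {d | x ∈ D ∧ ∀ z ∈ D, h x + inner ℝ d (z - x) ≤ h z}

/-- The positive part `h⁺ = max {0, h}` of a real function. -/
def posPart {n : ℕ} (h : EuclideanSpace ℝ (Fin n) → ℝ) (x : EuclideanSpace ℝ (Fin n)) : ℝ :=
  max 0 (h x)

/-- The soft constraint set `X_i = {g_i ≤ 0}` of a convex function `g_i` with effective
domain `D_i`. -/
def softSet {n : ℕ} (D : Set (EuclideanSpace ℝ (Fin n)))
    (h : EuclideanSpace ℝ (Fin n) → ℝ) : Set (EuclideanSpace ℝ (Fin n)) :=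
  {x | x ∈ D ∧ h x ≤ 0}

/-- The feasible set `X = X₀ ∩ ⋂ i, X_i`. -/
def feasibleSet {n : ℕ} {ι : Type*} (X₀ : Set (EuclideanSpace ℝ (Fin n)))
    (D : ι → Set (EuclideanSpace ℝ (Fin n))) (g : ι → EuclideanSpace ℝ (Fin n) → ℝ) :
    Set (EuclideanSpace ℝ (Fin n)) :=
  X₀ ∩ ⋂ i, softSet (D i) (g i)

/-- Standing assumptions on the constraints. The extended-valued convex function `g_i` is given
by its effective domain `D i` and its real values there; it is finite on `X₀`, its positive part
has subgradients at the points of `X₀` outside `X_i`, and all subgradients of the `g_i⁺` over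
`X₀` are bounded by `Cg`. -/
structure ConstraintModel {n : ℕ} {ι : Type*} [MeasurableSpace ι]
    (X₀ : Set (EuclideanSpace ℝ (Fin n)))
    (D : ι → Set (EuclideanSpace ℝ (Fin n))) (g : ι → EuclideanSpace ℝ (Fin n) → ℝ)
    (Cg : ℝ) : Prop where
  closed_hard : IsClosed X₀
  convex_hard : Convex ℝ X₀
  finite_on_hard : ∀ i, X₀ ⊆ D i
  convex_fun : ∀ i, ConvexOn ℝ (D i) (g i)
  closed_soft : ∀ i, IsClosed (softSet (D i) (g i))
  measurable_index : ∀ x ∈ X₀, Measurable (fun i => g i x)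
  exists_subgradient : ∀ i, ∀ x ∈ X₀ \ softSet (D i) (g i),
    (subdifferential (D i) (posPart (g i)) x).Nonempty
  bound_pos : 0 < Cg
  subgradient_bound : ∀ x ∈ X₀, ∀ i, ∀ d ∈ subdifferential (D i) (posPart (g i)) x, ‖d‖ ≤ Cg

/-- The mean operator `T(x) = E[F(v, x)]`. -/
def meanOperator {n : ℕ} {Ω Ξ : Type*} [MeasurableSpace Ω] (P : Measure Ω) (v : Ω → Ξ)
    (F : Ξ → EuclideanSpace ℝ (Fin n) → EuclideanSpace ℝ (Fin n))
    (x : EuclideanSpace ℝ (Fin n)) : EuclideanSpace ℝ (Fin n) :=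
  ∫ ω, F (v ω) x ∂P

/-- The natural filtration
`𝓕_k = σ(ctrl_0, …, ctrl_{k-1}, v^0, …, v^{k-1})` of controls and operator samples. -/
@[reducible] def history {Ω Ξ ι : Type*} [MeasurableSpace Ξ] [MeasurableSpace ι]
    (ctrl : ℕ → Ω → ι) (vs : ℕ → Ω → Ξ) (k : ℕ) : MeasurableSpace Ω :=
  (⨆ i ∈ Finset.range k, MeasurableSpace.comap (ctrl i) inferInstance) ⊔
    (⨆ i ∈ Finset.range k, MeasurableSpace.comap (vs i) inferInstance)

/-- The random variable `w` is distributed as `v` and is independent of the σ-algebra `m`. -/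
structure IsFreshSample {Ω Ξ : Type*} (m : MeasurableSpace Ω) [MeasurableSpace Ω]
    [MeasurableSpace Ξ] (P : Measure Ω) (v w : Ω → Ξ) : Prop where
  measurable : Measurable w
  identDistrib : IdentDistrib w v P P
  indep : Indep (MeasurableSpace.comap w inferInstance) m P

/-- The incremental constraint projection method started at `x0`, with stepsizes `α k`, `β k`:
`y^k = Π_{X₀}[x^k - α_k F(v^k, x^k)]` and
`x^{k+1} = Π_{X₀}[y^k - β_k (g⁺_{ctrl_k}(y^k) / ‖d^k‖²) d^k]`,
where `d^k` is a nonzero subgradient of `g⁺_{ctrl_k}` at `y^k` if `g⁺_{ctrl_k}(y^k) > 0`, chosen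
measurably from the information available (the value of `d^k` is irrelevant otherwise). -/
structure IsMethod {n : ℕ} {Ω Ξ ι : Type*} [MeasurableSpace Ξ] [MeasurableSpace ι]
    (X₀ : Set (EuclideanSpace ℝ (Fin n)))
    (D : ι → Set (EuclideanSpace ℝ (Fin n))) (g : ι → EuclideanSpace ℝ (Fin n) → ℝ)
    (F : Ξ → EuclideanSpace ℝ (Fin n) → EuclideanSpace ℝ (Fin n))
    (ctrl : ℕ → Ω → ι) (vs : ℕ → Ω → Ξ) (α β : ℕ → ℝ)
    (x0 : EuclideanSpace ℝ (Fin n)) (x y d : ℕ → Ω → EuclideanSpace ℝ (Fin n)) : Prop where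
  init_mem : x0 ∈ X₀
  init : ∀ ω, x 0 ω = x0
  operator_step : ∀ k ω,
    IsProjection X₀ (x k ω - α k • F (vs k ω) (x k ω)) (y k ω)
  subgradient_measurable : ∀ k, Measurable[history ctrl vs (k + 1)] (d k)
  subgradient : ∀ k ω, 0 < posPart (g (ctrl k ω)) (y k ω) →
    d k ω ≠ 0 ∧ d k ω ∈ subdifferential (D (ctrl k ω)) (posPart (g (ctrl k ω))) (y k ω)
  feasibility_step : ∀ k ω,
    IsProjection X₀
      (y k ω - (β k * (posPart (g (ctrl k ω)) (y k ω) / ‖d k ω‖ ^ 2)) • d k ω) (x (k + 1) ω)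

/-- Constraint sampling and regularity: for `x ∈ X₀` and every `k`, almost surely
`dist(x, X)² ≤ c E[(g⁺_{ctrl_k}(x))² | 𝓕_k]`. -/
def ConstraintRegularity {n : ℕ} {Ω Ξ ι : Type*} [MeasurableSpace Ω] [MeasurableSpace Ξ]
    [MeasurableSpace ι] (P : Measure Ω) (X₀ : Set (EuclideanSpace ℝ (Fin n)))
    (D : ι → Set (EuclideanSpace ℝ (Fin n))) (g : ι → EuclideanSpace ℝ (Fin n) → ℝ)
    (ctrl : ℕ → Ω → ι) (vs : ℕ → Ω → Ξ) (c : ℝ) : Prop :=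
  ∀ x ∈ X₀, ∀ k, ∀ᵐ ω ∂P,
    Metric.infDist x (feasibleSet X₀ D g) ^ 2 ≤
      c * (P[fun ω' => posPart (g (ctrl k ω')) x ^ 2 | history ctrl vs k]) ω

/-- Weak sharpness with modulus `ρ`. -/
def WeakSharp {n : ℕ} (T : EuclideanSpace ℝ (Fin n) → EuclideanSpace ℝ (Fin n))
    (X : Set (EuclideanSpace ℝ (Fin n))) (ρ : ℝ) : Prop :=
  ∀ z ∈ solutionSet T X, ∀ x ∈ X,
    ρ * Metric.infDist x (solutionSet T X) ≤ inner ℝ (T z) (x - z)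

/-- Random Lipschitz continuity with a square-integrable modulus `ℓ(v)`, and finite second
moments of `F(v, x)`. -/
structure RandomLipschitz {n : ℕ} {Ω Ξ : Type*} [MeasurableSpace Ω] [MeasurableSpace Ξ]
    (P : Measure Ω) (v : Ω → Ξ)
    (F : Ξ → EuclideanSpace ℝ (Fin n) → EuclideanSpace ℝ (Fin n)) (ℓ : Ξ → ℝ) : Prop where
  measurable : Measurable ℓ
  nonneg : ∀ ξ, 0 ≤ ℓ ξ
  memLp : MemLp (fun ω => ℓ (v ω)) 2 P
  lipschitz : ∀ᵐ ω ∂P, ∀ x y, ‖F (v ω) y - F (v ω) x‖ ≤ ℓ (v ω) * ‖y - x‖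
  second_moment : ∀ x, MemLp (fun ω => F (v ω) x) 2 P

/-- Uniformly bounded second moments over `X₀`: `sup_{x ∈ X₀} E‖F(v, x)‖² ≤ 2 C_F²`. -/
structure BoundedSecondMoment {n : ℕ} {Ω Ξ : Type*} [MeasurableSpace Ω]
    (P : Measure Ω) (v : Ω → Ξ)
    (F : Ξ → EuclideanSpace ℝ (Fin n) → EuclideanSpace ℝ (Fin n))
    (X₀ : Set (EuclideanSpace ℝ (Fin n))) (CF : ℝ) : Prop where
  pos : 0 < CF
  memLp : ∀ x ∈ X₀, MemLp (fun ω => F (v ω) x) 2 P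
  bound : ∀ x ∈ X₀, ∫ ω, ‖F (v ω) x‖ ^ 2 ∂P ≤ 2 * CF ^ 2

/-- The stepsizes `α_0 = α_1 = θ`, `α_k = θ / √(k (ln k)^{1+lam})` for `k ≥ 2`. -/
def stepSize (θ lam : ℝ) (k : ℕ) : ℝ :=
  if k ≤ 1 then θ else θ / √((k : ℝ) * Real.log k ^ (1 + lam))

/-- The ergodic average `x̂^k = (∑_{i ≤ k} α_i x^i) / ∑_{i ≤ k} α_i`. -/
def ergodicAverage {n : ℕ} {Ω : Type*} (α : ℕ → ℝ)
    (x : ℕ → Ω → EuclideanSpace ℝ (Fin n)) (k : ℕ) (ω : Ω) : EuclideanSpace ℝ (Fin n) :=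
  (∑ i ∈ Finset.range (k + 1), α i)⁻¹ • ∑ i ∈ Finset.range (k + 1), α i • x i ω

/-- `B(x) = √(E‖F(v, x)‖²)`. -/
def rootMoment {n : ℕ} {Ω Ξ : Type*} [MeasurableSpace Ω] (P : Measure Ω) (v : Ω → Ξ)
    (F : Ξ → EuclideanSpace ℝ (Fin n) → EuclideanSpace ℝ (Fin n))
    (x : EuclideanSpace ℝ (Fin n)) : ℝ :=
  √(∫ ω, ‖F (v ω) x‖ ^ 2 ∂P)

/-- `L = √(E[ℓ(v)²])`. -/
def lipConst {Ω Ξ : Type*} [MeasurableSpace Ω] (P : Measure Ω) (v : Ω → Ξ) (ℓ : Ξ → ℝ) : ℝ :=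
  √(∫ ω, ℓ (v ω) ^ 2 ∂P)

/-- `G_τ = c C_g² τ / (τ - 1)`. -/
def constG (c Cg τ : ℝ) : ℝ := c * Cg ^ 2 * τ * (τ - 1)⁻¹

/-- `H_τ = 2 (1 + τ)`. -/
def constH (τ : ℝ) : ℝ := 2 * (1 + τ)

/-- The numerical constant `2 + 1 / (2 (ln 2)^{1+lam}) + 1 / (lam (ln 2)^lam)`. -/
def constS (lam : ℝ) : ℝ :=
  2 + 1 / (2 * Real.log 2 ^ (1 + lam)) + 1 / (lam * Real.log 2 ^ lam)

/-- `k₀ ≥ 2` is the least natural number with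
`k₀ ≥ exp[(2 (1 + τ) L² θ² / (lam β (2 - β) φ))^{1/lam}] + 1`. -/
def IsBurnIn (L θ lam β τ φ : ℝ) (k₀ : ℕ) : Prop :=
  IsLeast {m : ℕ | 2 ≤ m ∧
    Real.exp ((2 * (1 + τ) * L ^ 2 * θ ^ 2 / (lam * β * (2 - β) * φ)) ^ (1 / lam)) + 1 ≤ m} k₀

/-- `I(z, k₀)`, where `M = max_{0 ≤ k ≤ k₀} E‖x^k - z‖²`, `C = ρ + B(z)` and `B = B(z)`. -/
def constI (M G H C B L φ : ℝ) : ℝ :=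
  (M + (G * H⁻¹ * C ^ 2 * (L ^ 2)⁻¹ + B ^ 2 * (L ^ 2)⁻¹) * φ) / (1 - φ)

/-- `max_{0 ≤ k ≤ k₀} E‖x^k - z‖²`. -/
def maxMoment {n : ℕ} {Ω : Type*} [MeasurableSpace Ω] (P : Measure Ω)
    (x : ℕ → Ω → EuclideanSpace ℝ (Fin n)) (k₀ : ℕ) (z : EuclideanSpace ℝ (Fin n)) : ℝ :=
  (Finset.range (k₀ + 1)).sup' Finset.nonempty_range_add_one
    (fun k => ∫ ω, ‖x k ω - z‖ ^ 2 ∂P)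

/-- `J_β(z, k₀, 1) = [I(z, k₀) L² + B(z)²] H_τ + G_τ C(z)² / (β (2 - β))`, where
`C(z) = ρ + B(z)`, `B = B(z)` and `M` is as in `constI`. -/
def constJ (M c Cg τ ρ B L φ β : ℝ) : ℝ :=
  (constI M (constG c Cg τ) (constH τ) (ρ + B) B L φ * L ^ 2 + B ^ 2) * constH τ +
    constG c Cg τ * (ρ + B) ^ 2 * (β * (2 - β))⁻¹

/-- The constant `V` in the unbounded case. -/
def constV {n : ℕ} {Ω Ξ : Type*} [MeasurableSpace Ω] (P : Measure Ω) (v : Ω → Ξ)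
    (F : Ξ → EuclideanSpace ℝ (Fin n) → EuclideanSpace ℝ (Fin n))
    (x : ℕ → Ω → EuclideanSpace ℝ (Fin n)) (x0 : EuclideanSpace ℝ (Fin n))
    (S : Set (EuclideanSpace ℝ (Fin n))) (k₀ : ℕ) (c Cg τ ρ L φ β θ lam : ℝ) : ℝ :=
  max θ θ⁻¹ / 2 *
    ⨅ z : S, (‖x0 - (z : EuclideanSpace ℝ (Fin n))‖ ^ 2 +
      constJ (maxMoment P x k₀ z) c Cg τ ρ (rootMoment P v F z) L φ β * constS lam)

/-- `Ĵ_β[1] = H_τ C_F² + G_τ (ρ + √2 C_F)² / (β (2 - β))`. -/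
def constJhat (c Cg τ ρ CF β : ℝ) : ℝ :=
  constH τ * CF ^ 2 + constG c Cg τ * (ρ + √2 * CF) ^ 2 * (β * (2 - β))⁻¹

/-- The constant `V` in the bounded case. -/
def constVhat {n : ℕ} (x0 : EuclideanSpace ℝ (Fin n)) (S : Set (EuclideanSpace ℝ (Fin n)))
    (c Cg τ ρ CF β θ lam : ℝ) : ℝ :=
  max θ θ⁻¹ / 2 * (Metric.infDist x0 S ^ 2 + constJhat c Cg τ ρ CF β * constS lam)

/-- With threshold constant `V`: for every `k ≥ 2` with `k (ln k)^{1+lam} ≥ 1` (that is,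
`α_k ≤ α_0`, which is automatic for `k ≥ 3`) and
`k / (ln k)^{1+lam} > (V L^{1/δ} / ρ^{1+1/δ})²`, and every sample `w` of `v` independent of
`𝓕_k` (for instance `w = v^k`), the expectation `E[F(w, x̂^k)]` exists and the minimizers over
`X` of the linear function `x ↦ ⟨E[F(w, x̂^k)], x⟩` solve the variational inequality. -/
def AuxiliaryProgramSolves {n : ℕ} {Ω Ξ ι : Type*} [MeasurableSpace Ω] [MeasurableSpace Ξ]
    [MeasurableSpace ι] (P : Measure Ω) (v : Ω → Ξ)
    (F : Ξ → EuclideanSpace ℝ (Fin n) → EuclideanSpace ℝ (Fin n))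
    (X : Set (EuclideanSpace ℝ (Fin n)))
    (ctrl : ℕ → Ω → ι) (vs : ℕ → Ω → Ξ) (α : ℕ → ℝ)
    (x : ℕ → Ω → EuclideanSpace ℝ (Fin n)) (lam ρ L δ V : ℝ) : Prop :=
  ∀ k : ℕ, 2 ≤ k → 1 ≤ (k : ℝ) * Real.log k ^ (1 + lam) →
    (V * L ^ (1 / δ) / ρ ^ (1 + 1 / δ)) ^ 2 < (k : ℝ) / Real.log k ^ (1 + lam) →
    ∀ w : Ω → Ξ, IsFreshSample (history ctrl vs k) P v w →
      Integrable (fun ω => F (w ω) (ergodicAverage α x k ω)) P ∧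
      linearArgmin (∫ ω, F (w ω) (ergodicAverage α x k ω) ∂P) X ⊆
        solutionSet (meanOperator P v F) X

end SVI

end

/-! Write `S` for the solution set and fix `z` in `S`. The proof combines a rate for the expected
distance of the averages to `S` with an identification principle that turns a small expected
distance into exact solutions.

Rate. One iteration decreases `‖x - z‖²` up to a drift term, a noise term of order `α_k²`, and a
gain proportional to the squared constraint violation (`ConstraintModel.step_le`). In expectation,
independence of the sample replaces `F` by its mean `T`, and regularity bounds the gain from below
by a multiple of `E dist(x^k, X)²` (`ConstraintRegularity.integral_le`). Monotonicity and weak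
sharpness give the drift a lower bound `ρ dist(·, S) - (ρ + B) dist(·, X)` (`WeakSharp.drift`). The
iterates may be infeasible, but the linear loss in `dist(·, X)` is absorbed by the quadratic gain at
a cost `O(α_k²)` (`Setup.expected_step`). Summing, with `∑ α_k²` finite and `∑_{i ≤ k} α_i` at least
`θ √(k / (ln k)^{1+lam})`, and using convexity of the distance to `S`, bounds the expected distance
of the average. If second moments are not uniformly bounded, `E‖x^k - z‖²` must first be controlled:
past the burn-in index the remaining squared steps are too small for it to escape
(`bounded_of_recursion`).

Identification (`Setup.linearArgmin_subset`). If `p` is the projection of a random point `u` onto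
`S`, weak sharpness survives averaging: the vector `E T(p)` has slope at least `ρ` in the direction
from the projection onto `S` to any feasible point outside `S`. Hölder continuity and Jensen put `E
T(u)` within less than `ρ` of `E T(p)`, so no minimizer of the linear program at `E T(u)` lies
outside `S`. The threshold on `k` is exactly what makes the rate small enough for this. -/

namespace SVI

/-! ### Metric projections and distances to convex sets. -/

section Geometry

variable {n : ℕ} {C : Set (EuclideanSpace ℝ (Fin n))} {x y p q z : EuclideanSpace ℝ (Fin n)}

theorem IsProjection.infDist_eq (h : IsProjection C x p) : Metric.infDist x C = ‖x - p‖ := by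
  refine le_antisymm ?_ ?_
  · rw [← dist_eq_norm]
    exact Metric.infDist_le_dist_of_mem h.1
  · refine (Metric.le_infDist ⟨p, h.1⟩).2 fun z hz => ?_
    rw [dist_eq_norm]
    exact h.2 z hz

theorem exists_isProjection (hC : IsClosed C) (hne : C.Nonempty)
    (x : EuclideanSpace ℝ (Fin n)) : ∃ p, IsProjection C x p := by
  obtain ⟨p, hp, h⟩ := hC.exists_infDist_eq_dist hne x
  refine ⟨p, hp, fun z hz => ?_⟩
  rw [← dist_eq_norm, ← h, ← dist_eq_norm]
  exact Metric.infDist_le_dist_of_mem hz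

theorem isProjection_self (hx : x ∈ C) : IsProjection C x x :=
  ⟨hx, fun z _ => by simp⟩

theorem IsProjection.inner_nonpos (hC : Convex ℝ C) (h : IsProjection C x p) (hz : z ∈ C) :
    inner ℝ (x - p) (z - p) ≤ 0 := by
  have : Nonempty C := ⟨⟨p, h.1⟩⟩
  refine (norm_eq_iInf_iff_real_inner_le_zero hC h.1).1 ?_ z hz
  refine le_antisymm (le_ciInf fun w => h.2 w w.2) ?_
  exact ciInf_le (f := fun w : C => ‖x - w‖) ⟨0, by rintro _ ⟨w, rfl⟩; positivity⟩ ⟨p, h.1⟩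

theorem IsProjection.nonexpansive (hC : Convex ℝ C) (hp : IsProjection C x p)
    (hq : IsProjection C y q) : ‖p - q‖ ≤ ‖x - y‖ := by
  have h1 := hp.inner_nonpos hC hq.1
  have h2 := hq.inner_nonpos hC hp.1
  have h3 : ‖p - q‖ ^ 2 ≤ inner ℝ (x - y) (p - q) := by
    rw [← real_inner_self_eq_norm_sq]
    simp only [inner_sub_left, inner_sub_right] at *
    linarith
  have h4 := real_inner_le_norm (x - y) (p - q)
  by_contra! hlt
  nlinarith [norm_nonneg (x - y), norm_nonneg (p - q)]

/-- A choice of the metric projection onto `C`. -/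
noncomputable def proj (C : Set (EuclideanSpace ℝ (Fin n))) (x : EuclideanSpace ℝ (Fin n)) :
    EuclideanSpace ℝ (Fin n) :=
  Classical.epsilon (IsProjection C x)

theorem isProjection_proj (hC : IsClosed C) (hne : C.Nonempty) (x : EuclideanSpace ℝ (Fin n)) :
    IsProjection C x (proj C x) :=
  Classical.epsilon_spec (exists_isProjection hC hne x)

theorem continuous_proj (hC : IsClosed C) (hcv : Convex ℝ C) (hne : C.Nonempty) :
    Continuous (proj C) := by
  refine (LipschitzWith.of_dist_le_mul (K := 1) fun x y => ?_).continuous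
  simpa [dist_eq_norm] using
    (isProjection_proj hC hne x).nonexpansive hcv (isProjection_proj hC hne y)

/-- Uniqueness of the projection turns the relational description of the method into a formula with
the continuous map `proj`, from which measurability of the iterates follows. -/
theorem IsProjection.eq_proj (hC : IsClosed C) (hcv : Convex ℝ C) (h : IsProjection C x p) :
    p = proj C x := by
  have := h.nonexpansive hcv (isProjection_proj hC ⟨p, h.1⟩ x)
  rw [sub_self, norm_zero] at this
  exact sub_eq_zero.1 (norm_le_zero_iff.1 this)

/-- The same weighted average of the projections stays in `C`, so it competes in the distance on the
left. This is convexity of the distance function, used for ergodic averages. -/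
theorem infDist_weighted_sum_le (hC : IsClosed C) (hcv : Convex ℝ C) (hne : C.Nonempty)
    {s : Finset ℕ} {w : ℕ → ℝ} (hw : ∀ i ∈ s, 0 ≤ w i) (hs : 0 < ∑ i ∈ s, w i)
    (u : ℕ → EuclideanSpace ℝ (Fin n)) :
    Metric.infDist ((∑ i ∈ s, w i)⁻¹ • ∑ i ∈ s, w i • u i) C ≤
      (∑ i ∈ s, w i)⁻¹ * ∑ i ∈ s, w i * Metric.infDist (u i) C := by
  have hmem : (∑ i ∈ s, w i)⁻¹ • ∑ i ∈ s, w i • proj C (u i) ∈ C := by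
    have := hcv.centerMass_mem (t := s) (w := w) (z := fun i => proj C (u i)) hw hs
      (fun i _ => (isProjection_proj hC hne _).1)
    simpa [Finset.centerMass] using this
  refine (Metric.infDist_le_dist_of_mem hmem).trans ?_
  rw [dist_eq_norm, ← smul_sub, ← Finset.sum_sub_distrib, norm_smul, Real.norm_of_nonneg
    (inv_nonneg.2 hs.le)]
  refine mul_le_mul_of_nonneg_left ((norm_sum_le _ _).trans ?_) (inv_nonneg.2 hs.le)
  refine Finset.sum_le_sum fun i hi => ?_
  rw [← smul_sub, norm_smul, Real.norm_of_nonneg (hw i hi),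
    (isProjection_proj hC hne (u i)).infDist_eq]

theorem infDist_le_infDist_add_norm (C : Set (EuclideanSpace ℝ (Fin n))) (x y) :
    Metric.infDist x C ≤ Metric.infDist y C + ‖x - y‖ := by
  rw [← dist_eq_norm]
  exact Metric.infDist_le_infDist_add_dist

theorem infDist_le_norm (hz : z ∈ C) : Metric.infDist x C ≤ ‖x - z‖ := by
  rw [← dist_eq_norm]
  exact Metric.infDist_le_dist_of_mem hz

end Geometry

/-! ### Closedness and convexity of the solution set. -/

section SolutionSet

variable {n : ℕ} {T : EuclideanSpace ℝ (Fin n) → EuclideanSpace ℝ (Fin n)}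
  {X : Set (EuclideanSpace ℝ (Fin n))}

/-- Minty's lemma. In this form the conditions on `z` are affine, which is what makes the solution
set convex. The converse tests the inequality on the segment from `z` to `y` and lets the parameter
tend to zero. -/
theorem mem_solutionSet_iff_minty (hX : Convex ℝ X) (hT : Continuous T)
    (hmono : ∀ a b : EuclideanSpace ℝ (Fin n), 0 ≤ inner ℝ (T b - T a) (b - a))
    {z : EuclideanSpace ℝ (Fin n)} :
    z ∈ solutionSet T X ↔ z ∈ X ∧ ∀ y ∈ X, 0 ≤ inner ℝ (T y) (y - z) := by
  refine ⟨fun h => ⟨h.1, fun y hy => ?_⟩, fun h => ⟨h.1, fun y hy => ?_⟩⟩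
  · have h1 := h.2 y hy
    have h2 := hmono z y
    rw [inner_sub_left] at h2
    linarith
  · have hlim : Filter.Tendsto (fun t : ℝ => inner ℝ (T (z + t • (y - z))) (y - z))
        (nhdsWithin 0 (Set.Ioi 0)) (nhds (inner ℝ (T z) (y - z))) := by
      have hc : Continuous (fun t : ℝ => inner ℝ (T (z + t • (y - z))) (y - z)) := by fun_prop
      simpa using (hc.tendsto 0).mono_left nhdsWithin_le_nhds
    refine ge_of_tendsto hlim ?_
    filter_upwards [Ioo_mem_nhdsGT (zero_lt_one (α := ℝ))] with t ht
    have hmem : z + t • (y - z) ∈ X := hX.add_smul_sub_mem h.1 hy ⟨ht.1.le, ht.2.le⟩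
    have := h.2 _ hmem
    rw [add_sub_cancel_left, inner_smul_right] at this
    exact nonneg_of_mul_nonneg_right this ht.1

theorem isClosed_solutionSet (hX : IsClosed X) (hT : Continuous T) :
    IsClosed (solutionSet T X) := by
  have : solutionSet T X = X ∩ ⋂ y ∈ X, {z | 0 ≤ inner ℝ (T z) (y - z)} := by
    ext z
    simp [solutionSet]
  rw [this]
  refine hX.inter (isClosed_biInter fun y _ => isClosed_le continuous_const ?_)
  fun_prop

theorem convex_solutionSet (hX : Convex ℝ X) (hT : Continuous T)
    (hmono : ∀ a b : EuclideanSpace ℝ (Fin n), 0 ≤ inner ℝ (T b - T a) (b - a)) :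
    Convex ℝ (solutionSet T X) := by
  intro a ha b hb s t hs ht hst
  rw [mem_solutionSet_iff_minty hX hT hmono] at *
  refine ⟨hX ha.1 hb.1 hs ht hst, fun y hy => ?_⟩
  have h : y - (s • a + t • b) = s • (y - a) + t • (y - b) := by
    rw [smul_sub, smul_sub]
    nth_rewrite 1 [← one_smul ℝ y]
    rw [← hst, add_smul]
    abel
  rw [h, inner_add_right, inner_smul_right, inner_smul_right]
  exact add_nonneg (mul_nonneg hs (ha.2 y hy)) (mul_nonneg ht (hb.2 y hy))

end SolutionSet

/-! ### Constraint functions and the deterministic one-step inequality. -/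

section Constraints

variable {n : ℕ} {ι : Type*} [MeasurableSpace ι] {X₀ : Set (EuclideanSpace ℝ (Fin n))}
  {D : ι → Set (EuclideanSpace ℝ (Fin n))} {g : ι → EuclideanSpace ℝ (Fin n) → ℝ} {Cg : ℝ}

theorem ConstraintModel.isClosed_feasibleSet (h : ConstraintModel X₀ D g Cg) :
    IsClosed (feasibleSet X₀ D g) :=
  h.closed_hard.inter (isClosed_iInter h.closed_soft)

theorem ConstraintModel.convex_feasibleSet (h : ConstraintModel X₀ D g Cg) :
    Convex ℝ (feasibleSet X₀ D g) :=
  h.convex_hard.inter (convex_iInter fun i => (h.convex_fun i).convex_le 0)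

theorem posPart_nonneg (f : EuclideanSpace ℝ (Fin n) → ℝ) (x) : 0 ≤ posPart f x :=
  le_max_left _ _

theorem posPart_eq_zero {ι : Type*} {D : ι → Set (EuclideanSpace ℝ (Fin n))}
    {g : ι → EuclideanSpace ℝ (Fin n) → ℝ} {x : EuclideanSpace ℝ (Fin n)} (hx : x ∈ feasibleSet X₀ D g) (i : ι) :
    posPart (g i) x = 0 :=
  max_eq_left ((Set.mem_iInter.1 hx.2 i).2)

/-- A bounded subgradient at `a` controls the drop from `a` to `b`; where no subgradient is
guaranteed the left side is zero. Exchanging the points gives a Lipschitz bound on `X₀`. -/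
theorem ConstraintModel.posPart_le (h : ConstraintModel X₀ D g Cg) (i : ι)
    {a b : EuclideanSpace ℝ (Fin n)} (ha : a ∈ X₀) (hb : b ∈ X₀) :
    posPart (g i) a ≤ posPart (g i) b + Cg * ‖a - b‖ := by
  by_cases hs : a ∈ softSet (D i) (g i)
  · rw [show posPart (g i) a = 0 from max_eq_left hs.2]
    have := posPart_nonneg (g i) b
    have := h.bound_pos
    positivity
  · obtain ⟨d, hd⟩ := h.exists_subgradient i a ⟨ha, hs⟩
    have h1 := hd.2 b (h.finite_on_hard i hb)
    have h2 := abs_le.1 (abs_real_inner_le_norm d (b - a))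
    have h3 := mul_le_mul_of_nonneg_right (h.subgradient_bound a ha i d hd) (norm_nonneg (b - a))
    rw [norm_sub_rev a b]
    linarith

theorem ConstraintModel.posPart_lipschitz (h : ConstraintModel X₀ D g Cg) (i : ι)
    {a b : EuclideanSpace ℝ (Fin n)} (ha : a ∈ X₀) (hb : b ∈ X₀) :
    |posPart (g i) a - posPart (g i) b| ≤ Cg * ‖a - b‖ := by
  have h1 := h.posPart_le i ha hb
  have h2 := h.posPart_le i hb ha
  rw [norm_sub_rev b a] at h2
  exact abs_sub_le_iff.2 ⟨by linarith, by linarith⟩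

theorem ConstraintModel.posPart_le_of_mem (h : ConstraintModel X₀ D g Cg) (i : ι)
    {a z : EuclideanSpace ℝ (Fin n)} (ha : a ∈ X₀) (hz : z ∈ feasibleSet X₀ D g) :
    posPart (g i) a ≤ Cg * ‖a - z‖ := by
  simpa [posPart_eq_zero hz] using h.posPart_le i ha hz.1

/-- The pointwise decrease of the squared distance to a feasible point in one iteration. -/
theorem ConstraintModel.step_le (h : ConstraintModel X₀ D g Cg) {i : ι}
    {x y d x' f z : EuclideanSpace ℝ (Fin n)} {a β τ : ℝ} (ha : 0 ≤ a) (hβ : 0 < β)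
    (hβ2 : β < 2) (hτ : 1 < τ) (hx : x ∈ X₀) (hz : z ∈ feasibleSet X₀ D g)
    (hy : IsProjection X₀ (x - a • f) y)
    (hd : 0 < posPart (g i) y → d ≠ 0 ∧ d ∈ subdifferential (D i) (posPart (g i)) y)
    (hx' : IsProjection X₀ (y - (β * (posPart (g i) y / ‖d‖ ^ 2)) • d) x') :
    ‖x' - z‖ ^ 2 ≤ ‖x - z‖ ^ 2 - 2 * a * inner ℝ f (x - z) + τ * a ^ 2 * ‖f‖ ^ 2 -
      β * (2 - β) * (τ - 1) / (τ * Cg ^ 2) * posPart (g i) x ^ 2 := by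
  have hC := h.bound_pos
  have hzz := isProjection_self hz.1
  have h1 : ‖y - z‖ ^ 2 ≤ ‖x - z‖ ^ 2 - 2 * a * inner ℝ f (x - z) + a ^ 2 * ‖f‖ ^ 2 := by
    have h2 := hy.nonexpansive h.convex_hard hzz
    have h3 : ‖x - a • f - z‖ ^ 2 =
        ‖x - z‖ ^ 2 - 2 * a * inner ℝ f (x - z) + a ^ 2 * ‖f‖ ^ 2 := by
      rw [sub_right_comm, norm_sub_sq_real, inner_smul_right, norm_smul, mul_pow,
        Real.norm_eq_abs, sq_abs, real_inner_comm]
      ring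
    rw [← h3]
    gcongr
  have h4 : ‖x - y‖ ≤ a * ‖f‖ := by
    have := (isProjection_self hx).nonexpansive h.convex_hard hy
    rwa [sub_sub_cancel, norm_smul, Real.norm_of_nonneg ha] at this
  -- The feasibility step is a relaxed Polyak step: the subgradient inequality at the feasible `z`
  -- yields the factor `2β - β²`. If the violation is zero, the step vanishes whatever `d` is.
  have h5 : ‖x' - z‖ ^ 2 ≤ ‖y - z‖ ^ 2 - β * (2 - β) / Cg ^ 2 * posPart (g i) y ^ 2 := by
    have h6 := hx'.nonexpansive h.convex_hard hzz
    rcases (posPart_nonneg (g i) y).eq_or_lt with h0 | h0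
    · rw [← h0] at h6 ⊢
      simp only [zero_div, mul_zero, zero_smul, sub_zero, ne_eq, OfNat.ofNat_ne_zero,
        not_false_eq_true, zero_pow] at h6 ⊢
      gcongr
    · obtain ⟨hd0, hds⟩ := hd h0
      set γ := posPart (g i) y
      have hdn : 0 < ‖d‖ := norm_pos_iff.2 hd0
      have h7 := hds.2 z (h.finite_on_hard i hz.1)
      rw [posPart_eq_zero hz] at h7
      have h8 : γ ≤ inner ℝ d (y - z) := by
        rw [← neg_sub y z, inner_neg_right] at h7
        linarith
      have h9 := h.subgradient_bound y hy.1 i d hds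
      have h10 : ‖y - (β * (γ / ‖d‖ ^ 2)) • d - z‖ ^ 2 =
          ‖y - z‖ ^ 2 - 2 * (β * (γ / ‖d‖ ^ 2)) * inner ℝ d (y - z) +
            β ^ 2 * γ ^ 2 / ‖d‖ ^ 2 := by
        rw [sub_right_comm, norm_sub_sq_real, inner_smul_right, norm_smul, mul_pow,
          Real.norm_eq_abs, sq_abs, real_inner_comm]
        field_simp
      have h11 : β * (γ / ‖d‖ ^ 2) * γ ≤ β * (γ / ‖d‖ ^ 2) * inner ℝ d (y - z) := by gcongr
      have h12 : β * (2 - β) / Cg ^ 2 * γ ^ 2 ≤ β * (2 - β) / ‖d‖ ^ 2 * γ ^ 2 := by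
        have : 0 ≤ β * (2 - β) := mul_nonneg hβ.le (by linarith)
        gcongr
      calc ‖x' - z‖ ^ 2 ≤ ‖y - (β * (γ / ‖d‖ ^ 2)) • d - z‖ ^ 2 := by gcongr
        _ ≤ ‖y - z‖ ^ 2 - 2 * (β * (γ / ‖d‖ ^ 2) * γ) + β ^ 2 * γ ^ 2 / ‖d‖ ^ 2 := by
          rw [h10]; linarith
        _ = ‖y - z‖ ^ 2 - β * (2 - β) / ‖d‖ ^ 2 * γ ^ 2 := by field_simp; ring
        _ ≤ _ := by linarith
  -- Young's inequality with parameter `τ` transfers the violation from `y` back to `x`, a point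
  -- known before the current sample and control.
  have h13 : (τ - 1) / τ * posPart (g i) x ^ 2 ≤
      posPart (g i) y ^ 2 + (τ - 1) * (Cg ^ 2 * (a ^ 2 * ‖f‖ ^ 2)) := by
    have h14 : posPart (g i) x ≤ posPart (g i) y + Cg * (a * ‖f‖) :=
      (h.posPart_le i hx hy.1).trans (by gcongr)
    have h15 : posPart (g i) x ^ 2 ≤ (posPart (g i) y + Cg * (a * ‖f‖)) ^ 2 := by
      have := posPart_nonneg (g i) x
      gcongr
    have hτ0 : 0 < τ := by linarith
    have hτ1 : 0 < τ - 1 := by linarith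
    rw [div_mul_eq_mul_div, div_le_iff₀ hτ0]
    have h16 := mul_le_mul_of_nonneg_left h15 hτ1.le
    nlinarith [sq_nonneg (posPart (g i) y - (τ - 1) * (Cg * (a * ‖f‖)))]
  have hb0 : 0 ≤ β * (2 - β) := mul_nonneg hβ.le (by linarith)
  have hb1 : β * (2 - β) ≤ 1 := by nlinarith [sq_nonneg (β - 1)]
  have h17 := mul_le_mul_of_nonneg_left h13 (div_nonneg hb0 (sq_nonneg Cg))
  have h18 : β * (2 - β) / Cg ^ 2 * (posPart (g i) y ^ 2 +
      (τ - 1) * (Cg ^ 2 * (a ^ 2 * ‖f‖ ^ 2))) = β * (2 - β) / Cg ^ 2 * posPart (g i) y ^ 2 +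
      β * (2 - β) * ((τ - 1) * (a ^ 2 * ‖f‖ ^ 2)) := by
    field_simp
  -- Together with the `a² ‖f‖²` from the operator step, this makes the noise coefficient `1 + (τ -
  -- 1) = τ`.
  have h19 : β * (2 - β) * ((τ - 1) * (a ^ 2 * ‖f‖ ^ 2)) ≤ 1 * ((τ - 1) * (a ^ 2 * ‖f‖ ^ 2)) :=
    mul_le_mul_of_nonneg_right hb1 (mul_nonneg (by linarith) (by positivity))
  have h20 : β * (2 - β) * (τ - 1) / (τ * Cg ^ 2) * posPart (g i) x ^ 2 =
      β * (2 - β) / Cg ^ 2 * ((τ - 1) / τ * posPart (g i) x ^ 2) := by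
    field_simp
  rw [h20]
  linarith

end Constraints

/-! ### Sums of stepsizes and of their squares. -/

section StepSize

open Real

/-- A discrete integral test: the convex function `t ↦ t^{-lam}` lies above its tangent at `log (m +
1)`, and the increment of `log` is at least `1 / (m + 1)`. The right side telescopes. -/
theorem inv_mul_log_rpow_le {lam : ℝ} (hlam : 0 < lam) {m : ℕ} (hm : 2 ≤ m) :
    (((m + 1 : ℕ) : ℝ) * log (m + 1 : ℕ) ^ (1 + lam))⁻¹ ≤
      lam⁻¹ * ((log m ^ lam)⁻¹ - (log (m + 1 : ℕ) ^ lam)⁻¹) := by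
  have hm' : (2 : ℝ) ≤ m := by exact_mod_cast hm
  push_cast
  set u := log m
  set w := log ((m : ℝ) + 1)
  have hu : 0 < u := log_pos (by linarith)
  have huw : 1 / ((m : ℝ) + 1) ≤ w - u := by
    have h := log_le_sub_one_of_pos (x := m / ((m : ℝ) + 1)) (by positivity)
    rw [log_div (by positivity) (by positivity)] at h
    have : (m : ℝ) / (m + 1) - 1 = -(1 / (m + 1)) := by field_simp; ring
    rw [this] at h
    change log m - log ((m : ℝ) + 1) ≤ _ at h
    simp only [u, w]
    linarith
  have hw : 0 < w := by
    have : 0 < 1 / ((m : ℝ) + 1) := by positivity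
    linarith
  have h1 : (w ^ lam)⁻¹ + lam * (w ^ (1 + lam))⁻¹ * (w - u) ≤ (u ^ lam)⁻¹ := by
    have h2 : 1 + lam * (1 - u / w) ≤ ((u / w) ^ lam)⁻¹ := by
      rw [← rpow_neg (by positivity), rpow_def_of_pos (by positivity)]
      have h3 := add_one_le_exp (log (u / w) * -lam)
      have h4 := log_le_sub_one_of_pos (x := u / w) (by positivity)
      nlinarith
    rw [div_rpow hu.le hw.le, inv_div] at h2
    have hwl : 0 < w ^ lam := rpow_pos_of_pos hw _
    have hul : 0 < u ^ lam := rpow_pos_of_pos hu _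
    have h5 := mul_le_mul_of_nonneg_left h2 (inv_nonneg.2 hwl.le)
    rw [rpow_add hw, rpow_one]
    calc (w ^ lam)⁻¹ + lam * (w * w ^ lam)⁻¹ * (w - u)
        = (w ^ lam)⁻¹ * (1 + lam * (1 - u / w)) := by field_simp
      _ ≤ _ := h5
      _ = _ := by field_simp
  have hwl : 0 < w ^ (1 + lam) := rpow_pos_of_pos hw _
  rw [mul_inv, ← one_div]
  have h6 := mul_le_mul_of_nonneg_right huw (inv_nonneg.2 hwl.le)
  refine h6.trans ?_
  rw [← div_eq_inv_mul, le_div_iff₀ hlam]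
  linarith

variable {θ lam : ℝ}

theorem stepSize_of_two_le {k : ℕ} (hk : 2 ≤ k) :
    stepSize θ lam k = θ / √((k : ℝ) * log k ^ (1 + lam)) :=
  if_neg (by omega)

theorem mul_log_rpow_pos {k : ℕ} (hk : 2 ≤ k) : 0 < (k : ℝ) * log k ^ (1 + lam) := by
  have : (2 : ℝ) ≤ k := by exact_mod_cast hk
  exact mul_pos (by linarith) (rpow_pos_of_pos (log_pos (by linarith)) _)

theorem stepSize_pos (hθ : 0 < θ) (k : ℕ) : 0 < stepSize θ lam k := by
  by_cases hk : 2 ≤ k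
  · rw [stepSize_of_two_le hk]
    exact div_pos hθ (sqrt_pos.2 (mul_log_rpow_pos hk))
  · rw [stepSize, if_pos (by omega)]
    exact hθ

theorem stepSize_sq {k : ℕ} (hk : 2 ≤ k) :
    stepSize θ lam k ^ 2 = θ ^ 2 * ((k : ℝ) * log k ^ (1 + lam))⁻¹ := by
  rw [stepSize_of_two_le hk, div_pow, sq_sqrt (mul_log_rpow_pos hk).le, div_eq_mul_inv]

theorem sum_stepSize_sq_tail_le (hlam : 0 < lam) {m : ℕ} (hm : 2 ≤ m) (N : ℕ) :
    ∑ i ∈ Finset.Ico (m + 1) N, stepSize θ lam i ^ 2 ≤ θ ^ 2 * (lam * log m ^ lam)⁻¹ := by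
  have hpos : ∀ j : ℕ, 2 ≤ j → 0 < log j ^ lam := fun j hj => by
    have : (2 : ℝ) ≤ j := by exact_mod_cast hj
    exact rpow_pos_of_pos (log_pos (by linarith)) _
  rcases le_or_gt N m with hN | hN
  · rw [Finset.Ico_eq_empty_of_le (by omega), Finset.sum_empty]
    have := hpos m hm
    positivity
  -- The negative end term of the telescoping sum is kept so that the induction closes, and
  -- discarded afterwards.
  · suffices ∑ i ∈ Finset.Ico (m + 1) N, stepSize θ lam i ^ 2 ≤
        θ ^ 2 * (lam⁻¹ * ((log m ^ lam)⁻¹ - (log (N - 1 : ℕ) ^ lam)⁻¹)) by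
      refine this.trans ?_
      have h1 := hpos (N - 1) (by omega)
      rw [mul_inv]
      gcongr
      linarith [inv_pos.2 h1]
    obtain ⟨N, rfl⟩ : ∃ j, N = m + 1 + j := ⟨N - (m + 1), by omega⟩
    clear hN
    induction N with
    | zero => simp
    | succ j ih =>
      rw [← add_assoc, Finset.sum_Ico_succ_top (by omega), stepSize_sq (by omega)]
      have h2 := inv_mul_log_rpow_le hlam (m := m + j) (by omega)
      have h3 : m + 1 + j - 1 = m + j := by omega
      have h4 : m + 1 + j + 1 - 1 = m + j + 1 := by omega
      have h5 : m + 1 + j = m + j + 1 := by omega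
      rw [h3] at ih
      rw [h4]
      rw [h5] at ih ⊢
      have h6 := mul_le_mul_of_nonneg_left h2 (sq_nonneg θ)
      linarith

theorem sum_stepSize_sq_le (hlam : 0 < lam) (N : ℕ) :
    ∑ i ∈ Finset.range N, stepSize θ lam i ^ 2 ≤ θ ^ 2 * constS lam := by
  -- Padding to `3 + N` lets the indices 0, 1, 2 be split off for every `N`; they give the first two
  -- terms of `constS`, and the tail from 3 gives the last.
  have h1 : ∑ i ∈ Finset.range N, stepSize θ lam i ^ 2 ≤
      ∑ i ∈ Finset.range (3 + N), stepSize θ lam i ^ 2 :=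
    Finset.sum_le_sum_of_subset_of_nonneg (Finset.range_mono (by omega))
      fun _ _ _ => sq_nonneg _
  refine h1.trans ?_
  rw [Finset.range_eq_Ico, ← Finset.sum_Ico_consecutive _ (Nat.zero_le 3) (by omega)]
  have h2 := sum_stepSize_sq_tail_le (θ := θ) hlam le_rfl (3 + N)
  have h3 : ∑ i ∈ Finset.Ico 0 3, stepSize θ lam i ^ 2 =
      θ ^ 2 + θ ^ 2 + θ ^ 2 * (2 * log 2 ^ (1 + lam))⁻¹ := by
    rw [← Finset.range_eq_Ico]
    simp only [Finset.sum_range_succ, Finset.sum_range_zero, zero_add]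
    rw [stepSize_sq le_rfl]
    simp [stepSize]
  rw [h3, constS]
  push_cast at h2
  simp only [one_div]
  linarith

theorem stepSize_le_of_le (hθ : 0 < θ) (hlam : 0 < lam) {i k : ℕ} (hk : 2 ≤ k) (hik : i ≤ k)
    (h1 : 1 ≤ (k : ℝ) * log k ^ (1 + lam)) : stepSize θ lam k ≤ stepSize θ lam i := by
  rw [stepSize_of_two_le hk]
  by_cases hi : 2 ≤ i
  · rw [stepSize_of_two_le hi]
    have hi' : (2 : ℝ) ≤ i := by exact_mod_cast hi
    have hl : 0 < log i := log_pos (by linarith)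
    have := sqrt_pos.2 (mul_log_rpow_pos (lam := lam) hi)
    gcongr
  · rw [stepSize, if_pos (by omega)]
    exact div_le_self hθ.le (one_le_sqrt.2 h1)

/-- The left side equals `k α_k`, and `α_k` is the smallest step up to `k`; `h1` is needed to
compare it with `α_0` and `α_1`. -/
theorem mul_sqrt_le_sum_stepSize (hθ : 0 < θ) (hlam : 0 < lam) {k : ℕ} (hk : 2 ≤ k)
    (h1 : 1 ≤ (k : ℝ) * log k ^ (1 + lam)) :
    θ * √((k : ℝ) / log k ^ (1 + lam)) ≤ ∑ i ∈ Finset.range (k + 1), stepSize θ lam i := by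
  have hk' : (2 : ℝ) ≤ k := by exact_mod_cast hk
  have hl : 0 < log k ^ (1 + lam) := rpow_pos_of_pos (log_pos (by linarith)) _
  have h2 : θ * √((k : ℝ) / log k ^ (1 + lam)) = k * stepSize θ lam k := by
    rw [stepSize_of_two_le hk, sqrt_div (by positivity), sqrt_mul (by positivity)]
    have := sqrt_pos.2 hl
    have : 0 < √(k : ℝ) := sqrt_pos.2 (by linarith)
    field_simp
    rw [sq_sqrt (by positivity)]
  rw [h2, Finset.sum_range_succ]
  have h3 : (k : ℝ) * stepSize θ lam k ≤ ∑ i ∈ Finset.range k, stepSize θ lam i := by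
    have := Finset.card_nsmul_le_sum (Finset.range k) (stepSize θ lam) (stepSize θ lam k)
      fun i hi => stepSize_le_of_le hθ hlam hk (Finset.mem_range.1 hi).le h1
    simpa using this
  linarith [stepSize_pos (lam := lam) hθ k]

theorem constS_pos (hlam : 0 < lam) : 0 < constS lam := by
  have : 0 < log 2 := log_pos (by norm_num)
  rw [constS]
  positivity

end StepSize

/-! ### The filtration and measurability of the iterates. -/

section History

variable {Ω Ξ ι : Type*} [MeasurableSpace Ξ] [MeasurableSpace ι] {ctrl : ℕ → Ω → ι}
  {vs : ℕ → Ω → Ξ}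

theorem history_mono {j k : ℕ} (h : j ≤ k) : history ctrl vs j ≤ history ctrl vs k :=
  sup_le_sup (biSup_mono fun _ hi => Finset.range_mono h hi)
    (biSup_mono fun _ hi => Finset.range_mono h hi)

theorem history_le [mΩ : MeasurableSpace Ω] (hctrl : ∀ k, Measurable (ctrl k))
    (hvs : ∀ k, Measurable (vs k)) (k : ℕ) : history ctrl vs k ≤ mΩ :=
  sup_le (iSup₂_le fun i _ => (hctrl i).comap_le) (iSup₂_le fun i _ => (hvs i).comap_le)

theorem measurable_ctrl_history (k : ℕ) : Measurable[history ctrl vs (k + 1)] (ctrl k) :=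
  measurable_iff_comap_le.2 <| le_sup_of_le_left <|
    le_iSup₂_of_le k (Finset.self_mem_range_succ k) le_rfl

theorem measurable_sample_history (k : ℕ) : Measurable[history ctrl vs (k + 1)] (vs k) :=
  measurable_iff_comap_le.2 <| le_sup_of_le_right <|
    le_iSup₂_of_le k (Finset.self_mem_range_succ k) le_rfl

end History

section Measurability

variable {n : ℕ} {Ω Ξ ι : Type*} [MeasurableSpace Ξ] [MeasurableSpace ι]
  {X₀ : Set (EuclideanSpace ℝ (Fin n))} {D : ι → Set (EuclideanSpace ℝ (Fin n))}
  {g : ι → EuclideanSpace ℝ (Fin n) → ℝ} {Cg : ℝ}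

theorem ConstraintModel.measurable_posPart (h : ConstraintModel X₀ D g Cg) {m : MeasurableSpace Ω}
    {j : Ω → ι} {u : Ω → EuclideanSpace ℝ (Fin n)} (hj : Measurable j) (hu : Measurable u)
    (hmem : ∀ ω, u ω ∈ X₀) : Measurable fun ω => posPart (g (j ω)) (u ω) := by
  -- A Carathéodory function: Lipschitz in the point and measurable in the index. Both properties
  -- are available only on `X₀`, hence the subtype.
  have h1 : Measurable (Function.uncurry fun (a : X₀) (i : ι) => posPart (g i) a) := by
    refine measurable_uncurry_of_continuous_of_measurable (fun i => ?_) fun a => ?_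
    · refine (LipschitzWith.of_dist_le_mul (K := ⟨Cg, h.bound_pos.le⟩) fun a b => ?_).continuous
      rw [Real.dist_eq, Subtype.dist_eq, dist_eq_norm]
      exact h.posPart_lipschitz i a.2 b.2
    · exact measurable_const.max (h.measurable_index a a.2)
  exact h1.comp ((hu.subtype_mk (h := hmem)).prodMk hj)

variable {F : Ξ → EuclideanSpace ℝ (Fin n) → EuclideanSpace ℝ (Fin n)} {ctrl : ℕ → Ω → ι}
  {vs : ℕ → Ω → Ξ} {α β : ℕ → ℝ} {x0 : EuclideanSpace ℝ (Fin n)}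
  {x y d : ℕ → Ω → EuclideanSpace ℝ (Fin n)}

theorem IsMethod.mem (hm : IsMethod X₀ D g F ctrl vs α β x0 x y d) (k : ℕ) (ω : Ω) :
    x k ω ∈ X₀ := by
  cases k with
  | zero => rw [hm.init]; exact hm.init_mem
  | succ k => exact (hm.feasibility_step k ω).1

theorem IsMethod.measurable_iterate (hm : IsMethod X₀ D g F ctrl vs α β x0 x y d)
    (hcon : ConstraintModel X₀ D g Cg) (hF : Measurable (Function.uncurry F)) (k : ℕ) :
    Measurable[history ctrl vs k] (x k) := by
  have hproj := (continuous_proj hcon.closed_hard hcon.convex_hard ⟨x0, hm.init_mem⟩).measurable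
  induction k with
  | zero =>
    rw [show x 0 = fun _ => x0 from funext hm.init]
    exact measurable_const
  | succ k ih =>
    let _ : MeasurableSpace Ω := history ctrl vs (k + 1)
    have hx : Measurable[history ctrl vs (k + 1)] (x k) :=
      ih.mono (history_mono k.le_succ) le_rfl
    have hvs := measurable_sample_history (ctrl := ctrl) (vs := vs) k
    have hct := measurable_ctrl_history (ctrl := ctrl) (vs := vs) k
    have hd := hm.subgradient_measurable k
    have hy' : y k = fun ω => proj X₀ (x k ω - α k • F (vs k ω) (x k ω)) :=
      funext fun ω => (hm.operator_step k ω).eq_proj hcon.closed_hard hcon.convex_hard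
    have hx' : x (k + 1) = fun ω => proj X₀
        (y k ω - (β k * (posPart (g (ctrl k ω)) (y k ω) / ‖d k ω‖ ^ 2)) • d k ω) :=
      funext fun ω => (hm.feasibility_step k ω).eq_proj hcon.closed_hard hcon.convex_hard
    have hFm : Measurable[history ctrl vs (k + 1)] fun ω => F (vs k ω) (x k ω) :=
      hF.comp (hvs.prodMk hx)
    have hy : Measurable[history ctrl vs (k + 1)] (y k) := by
      rw [hy']
      exact hproj.comp (hx.sub (hFm.const_smul (α k)))
    rw [hx']
    have hg := hcon.measurable_posPart hct hy fun ω => (hm.operator_step k ω).1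
    exact hproj.comp (hy.sub (((hg.div (hd.norm.pow_const 2)).const_mul (β k)).smul hd))

end Measurability

/-! ### Integration against an independent sample. -/

section Fresh

variable {n : ℕ} {Ω Ξ : Type*} {m : MeasurableSpace Ω} [mΩ : MeasurableSpace Ω]
  [MeasurableSpace Ξ] {P : Measure Ω} [IsProbabilityMeasure P] {v w : Ω → Ξ}
  {u : Ω → EuclideanSpace ℝ (Fin n)} {G : Type*} [NormedAddCommGroup G]

/-- The product form of the joint law replaces conditional expectations given the past by Fubini's
theorem. -/
theorem IsFreshSample.map_prodMk (hm : m ≤ mΩ) (h : IsFreshSample m P v w)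
    (hu : Measurable[m] u) :
    P.map (fun ω => (w ω, u ω)) = (P.map v).prod (P.map u) := by
  have hind : IndepFun w u P :=
    indep_of_indep_of_le_right h.indep hu.comap_le
  rw [(indepFun_iff_map_prod_eq_prod_map_map h.measurable.aemeasurable
    (hu.mono hm le_rfl).aemeasurable).1 hind, h.identDistrib.map_eq]

/-- Fubini's theorem for a sample independent of the conditioning variable. -/
theorem IsFreshSample.integral_comp_eq [NormedSpace ℝ G] (hm : m ≤ mΩ) (h : IsFreshSample m P v w)
    (hv : Measurable v) (hu : Measurable[m] u) {f : Ξ → EuclideanSpace ℝ (Fin n) → G}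
    (hf : StronglyMeasurable (Function.uncurry f))
    (hint : Integrable (fun ω => f (w ω) (u ω)) P) :
    ∫ ω, f (w ω) (u ω) ∂P = ∫ ω, ∫ ω', f (v ω') (u ω) ∂P ∂P := by
  have hu' : Measurable u := hu.mono hm le_rfl
  have hpair : Measurable fun ω => (w ω, u ω) := h.measurable.prodMk hu'
  have h1 : ∫ ω, f (w ω) (u ω) ∂P = ∫ p, Function.uncurry f p ∂((P.map v).prod (P.map u)) := by
    rw [← h.map_prodMk hm hu, integral_map hpair.aemeasurable hf.aestronglyMeasurable]
    rfl
  have hint' : Integrable (Function.uncurry f) ((P.map v).prod (P.map u)) := by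
    rw [← h.map_prodMk hm hu,
      integrable_map_measure hf.aestronglyMeasurable hpair.aemeasurable]
    exact hint
  rw [h1, integral_prod_symm _ hint', integral_map hu'.aemeasurable]
  · refine integral_congr_ae (.of_forall fun ω => ?_)
    exact integral_map hv.aemeasurable (hf.comp_measurable
      (measurable_id.prodMk measurable_const)).aestronglyMeasurable
  · exact hf.integral_prod_left.aestronglyMeasurable

/-- Fubini's criterion on the product law: slices are integrable at points of `A`, and `b` dominates
their norms by an integrable function of `u`. -/
theorem IsFreshSample.integrable_comp (hm : m ≤ mΩ) (h : IsFreshSample m P v w)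
    (hv : Measurable v) (hu : Measurable[m] u) {f : Ξ → EuclideanSpace ℝ (Fin n) → G}
    (hf : StronglyMeasurable (Function.uncurry f)) {A : Set (EuclideanSpace ℝ (Fin n))}
    (hA : MeasurableSet A) (huA : ∀ ω, u ω ∈ A)
    (hint : ∀ a ∈ A, Integrable (fun ω => f (v ω) a) P)
    {b : EuclideanSpace ℝ (Fin n) → ℝ} (hb : Measurable b)
    (hfb : ∀ a ∈ A, ∫ ω, ‖f (v ω) a‖ ∂P ≤ b a) (hbu : Integrable (fun ω => b (u ω)) P) :
    Integrable (fun ω => f (w ω) (u ω)) P := by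
  have hu' : Measurable u := hu.mono hm le_rfl
  have hpair : Measurable fun ω => (w ω, u ω) := h.measurable.prodMk hu'
  have hA' : ∀ᵐ a ∂(P.map u), a ∈ A :=
    (ae_map_iff hu'.aemeasurable hA).2 (.of_forall huA)
  have hslice : ∀ a, AEStronglyMeasurable (fun ξ => f ξ a) (P.map v) := fun a =>
    (hf.comp_measurable (measurable_id.prodMk measurable_const)).aestronglyMeasurable
  suffices Integrable (Function.uncurry f) (P.map fun ω => (w ω, u ω)) from
    (integrable_map_measure hf.aestronglyMeasurable hpair.aemeasurable).1 this
  rw [h.map_prodMk hm hu, integrable_prod_iff' hf.aestronglyMeasurable]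
  constructor
  · filter_upwards [hA'] with a ha
    exact (integrable_map_measure (hslice a) hv.aemeasurable).2 (hint a ha)
  · have hbi : Integrable b (P.map u) :=
      (integrable_map_measure hb.aestronglyMeasurable hu'.aemeasurable).2 hbu
    refine hbi.mono' hf.norm.integral_prod_left.aestronglyMeasurable ?_
    filter_upwards [hA'] with a ha
    rw [Real.norm_of_nonneg (integral_nonneg fun _ => norm_nonneg _)]
    refine le_trans (le_of_eq ?_) (hfb a ha)
    exact integral_map hv.aemeasurable (hslice a).norm

end Fresh

/-! ### The regularity condition at random points. -/

section Regularity

open Filter Topology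

variable {n : ℕ} {Ω Ξ ι : Type*} [mΩ : MeasurableSpace Ω] [MeasurableSpace Ξ] [MeasurableSpace ι]
  {P : Measure Ω} {X₀ : Set (EuclideanSpace ℝ (Fin n))} {D : ι → Set (EuclideanSpace ℝ (Fin n))}
  {g : ι → EuclideanSpace ℝ (Fin n) → ℝ} {Cg c : ℝ} {ctrl : ℕ → Ω → ι} {vs : ℕ → Ω → Ξ}

theorem ConstraintModel.integrable_posPart_sq (hcon : ConstraintModel X₀ D g Cg) {j : Ω → ι}
    (hj : Measurable j) {u : Ω → EuclideanSpace ℝ (Fin n)} (hu : Measurable u)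
    (hmem : ∀ ω, u ω ∈ X₀) {z : EuclideanSpace ℝ (Fin n)} (hz : z ∈ feasibleSet X₀ D g)
    (hint : Integrable (fun ω => ‖u ω - z‖ ^ 2) P) :
    Integrable (fun ω => posPart (g (j ω)) (u ω) ^ 2) P := by
  refine (hint.const_mul (Cg ^ 2)).mono'
    ((hcon.measurable_posPart hj hu hmem).pow_const 2).aestronglyMeasurable (.of_forall fun ω => ?_)
  rw [Real.norm_of_nonneg (sq_nonneg _), ← mul_pow]
  exact pow_le_pow_left₀ (posPart_nonneg _ _) (hcon.posPart_le_of_mem _ (hmem ω) hz) 2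

theorem integrable_infDist_sq {S : Set (EuclideanSpace ℝ (Fin n))}
    {u : Ω → EuclideanSpace ℝ (Fin n)} (hu : Measurable u)
    {z : EuclideanSpace ℝ (Fin n)} (hz : z ∈ S) (hint : Integrable (fun ω => ‖u ω - z‖ ^ 2) P) :
    Integrable (fun ω => Metric.infDist (u ω) S ^ 2) P := by
  refine hint.mono' (hu.infDist.pow_const 2).aestronglyMeasurable (.of_forall fun ω => ?_)
  rw [Real.norm_of_nonneg (sq_nonneg _)]
  exact pow_le_pow_left₀ Metric.infDist_nonneg (infDist_le_norm hz) 2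

theorem integral_simpleFunc_eq_sum {m : MeasurableSpace Ω} (hm : m ≤ mΩ)
    (s : @SimpleFunc Ω m (EuclideanSpace ℝ (Fin n))) {f : Ω → ℝ} (hf : Integrable f P) :
    ∫ ω, f ω ∂P = ∑ a ∈ s.range, ∫ ω in s ⁻¹' {a}, f ω ∂P := by
  have hU : (⋃ a ∈ s.range, s ⁻¹' {a}) = Set.univ := by
    ext ω
    simp
  rw [← setIntegral_univ, ← hU]
  refine integral_biUnion_finset _ (fun a _ => hm _ (s.measurableSet_fiber a)) ?_
    fun a _ => hf.integrableOn
  intro a _ b _ hab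
  exact Disjoint.preimage _ (Set.disjoint_singleton.2 hab)

/-- The exceptional null set in the regularity condition depends on the point, so a random point
cannot be substituted directly. With finitely many values this is harmless: each level set belongs
to the history, and the conditional expectation integrates correctly over it. -/
theorem ConstraintRegularity.integral_le_of_simpleFunc [IsFiniteMeasure P]
    (hreg : ConstraintRegularity P X₀ D g ctrl vs c) (hcon : ConstraintModel X₀ D g Cg)
    (hctrl : ∀ k, Measurable (ctrl k)) (hvs : ∀ k, Measurable (vs k)) (k : ℕ)
    {z : EuclideanSpace ℝ (Fin n)} (hz : z ∈ feasibleSet X₀ D g)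
    (s : @SimpleFunc Ω (history ctrl vs k) (EuclideanSpace ℝ (Fin n)))
    (hs : ∀ ω, s ω ∈ X₀) (hint : Integrable (fun ω => ‖s ω - z‖ ^ 2) P) :
    ∫ ω, Metric.infDist (s ω) (feasibleSet X₀ D g) ^ 2 ∂P ≤
      c * ∫ ω, posPart (g (ctrl k ω)) (s ω) ^ 2 ∂P := by
  have hm := history_le hctrl hvs k
  have hsm : Measurable s := (@SimpleFunc.measurable _ _ (history ctrl vs k) _ s).mono hm le_rfl
  rw [integral_simpleFunc_eq_sum hm s (integrable_infDist_sq hsm hz hint),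
    integral_simpleFunc_eq_sum hm s (hcon.integrable_posPart_sq (hctrl k) hsm hs hz hint),
    Finset.mul_sum]
  refine Finset.sum_le_sum fun a ha => ?_
  obtain ⟨ω₀, rfl⟩ := (@SimpleFunc.mem_range _ _ (history ctrl vs k) s _).1 ha
  set a := s ω₀
  have hA := @SimpleFunc.measurableSet_fiber _ _ (history ctrl vs k) s a
  have hA' := hm _ hA
  have hga : Integrable (fun ω => posPart (g (ctrl k ω)) a ^ 2) P :=
    hcon.integrable_posPart_sq (hctrl k) measurable_const (fun _ => hs ω₀) hz
      (integrable_const _)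
  have h1 : ∫ ω in s ⁻¹' {a}, Metric.infDist (s ω) (feasibleSet X₀ D g) ^ 2 ∂P =
      ∫ ω in s ⁻¹' {a}, Metric.infDist a (feasibleSet X₀ D g) ^ 2 ∂P :=
    setIntegral_congr_fun hA' fun ω hω => by
      rw [Set.mem_preimage, Set.mem_singleton_iff] at hω
      simp only [hω]
  have h2 : ∫ ω in s ⁻¹' {a}, posPart (g (ctrl k ω)) (s ω) ^ 2 ∂P =
      ∫ ω in s ⁻¹' {a}, posPart (g (ctrl k ω)) a ^ 2 ∂P :=
    setIntegral_congr_fun hA' fun ω hω => by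
      rw [Set.mem_preimage, Set.mem_singleton_iff] at hω
      simp only [hω]
  rw [h1, h2, ← setIntegral_condExp hm hga hA, ← integral_const_mul]
  exact setIntegral_mono_ae (integrable_const _).integrableOn
    (integrable_condExp.const_mul c).integrableOn (hreg a (hs ω₀) k)

/-- The regularity condition, integrated along a random point of `X₀` known at time `k`. -/
theorem ConstraintRegularity.integral_le [IsFiniteMeasure P]
    (hreg : ConstraintRegularity P X₀ D g ctrl vs c) (hcon : ConstraintModel X₀ D g Cg)
    (hctrl : ∀ k, Measurable (ctrl k)) (hvs : ∀ k, Measurable (vs k)) (k : ℕ)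
    {z : EuclideanSpace ℝ (Fin n)} (hz : z ∈ feasibleSet X₀ D g)
    {u : Ω → EuclideanSpace ℝ (Fin n)} (hu : Measurable[history ctrl vs k] u)
    (hmem : ∀ ω, u ω ∈ X₀) (hint : Integrable (fun ω => ‖u ω - z‖ ^ 2) P) :
    ∫ ω, Metric.infDist (u ω) (feasibleSet X₀ D g) ^ 2 ∂P ≤
      c * ∫ ω, posPart (g (ctrl k ω)) (u ω) ^ 2 ∂P := by
  have hm := history_le hctrl hvs k
  -- Approximants measurable for the history, with values in `X₀` and default value `z`. This
  -- default gives `‖s N - z‖ ≤ 2 ‖u - z‖`, hence the factor 4 in the dominating functions.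
  let s (N : ℕ) : @SimpleFunc Ω (history ctrl vs k) (EuclideanSpace ℝ (Fin n)) :=
    @SimpleFunc.approxOn _ _ _ _ _ (history ctrl vs k) u hu X₀ z hz.1 _ N
  have hsX : ∀ N ω, s N ω ∈ X₀ := fun N ω =>
    @SimpleFunc.approxOn_mem _ _ _ _ _ (history ctrl vs k) u hu X₀ z hz.1 _ N ω
  have hst : ∀ ω, Tendsto (fun N => s N ω) atTop (𝓝 (u ω)) := fun ω =>
    @SimpleFunc.tendsto_approxOn _ _ _ _ _ (history ctrl vs k) u hu X₀ z hz.1 _ ω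
      (subset_closure (hmem ω))
  have hsb : ∀ N ω, ‖s N ω - z‖ ≤ ‖u ω - z‖ + ‖u ω - z‖ := fun N ω =>
    @SimpleFunc.norm_approxOn_y₀_le _ _ (history ctrl vs k) _ _ _ u hu X₀ z hz.1 _ ω N
  have hsm : ∀ N, Measurable (s N) := fun N => (@SimpleFunc.measurable _ _ (history ctrl vs k) _ (s N)).mono hm le_rfl
  have hsb2 : ∀ N ω, ‖s N ω - z‖ ^ 2 ≤ 4 * ‖u ω - z‖ ^ 2 := fun N ω => by
    have := pow_le_pow_left₀ (norm_nonneg _) (hsb N ω) 2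
    linarith
  have hsi : ∀ N, Integrable (fun ω => ‖s N ω - z‖ ^ 2) P := fun N =>
    (hint.const_mul 4).mono' (((hsm N).sub_const z).norm.pow_const 2).aestronglyMeasurable
      (.of_forall fun ω => by
        rw [Real.norm_of_nonneg (sq_nonneg _)]
        exact hsb2 N ω)
  have hle := fun N => hreg.integral_le_of_simpleFunc hcon hctrl hvs k hz (s N) (hsX N) (hsi N)
  refine le_of_tendsto_of_tendsto' (b := atTop) ?_ (Tendsto.const_mul c ?_) hle
  · refine tendsto_integral_of_dominated_convergence (fun ω => 4 * ‖u ω - z‖ ^ 2)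
      (fun N => ((hsm N).infDist.pow_const 2).aestronglyMeasurable) (hint.const_mul 4)
      (fun N => .of_forall fun ω => ?_) (.of_forall fun ω => ?_)
    · rw [Real.norm_of_nonneg (sq_nonneg _)]
      exact (pow_le_pow_left₀ Metric.infDist_nonneg (infDist_le_norm hz) 2).trans (hsb2 N ω)
    · exact (((Metric.continuous_infDist_pt _).tendsto _).comp (hst ω)).pow 2
  · refine tendsto_integral_of_dominated_convergence (fun ω => Cg ^ 2 * (4 * ‖u ω - z‖ ^ 2))
      (fun N => ((hcon.measurable_posPart (hctrl k) (hsm N) (hsX N)).pow_const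
        2).aestronglyMeasurable) ((hint.const_mul 4).const_mul _)
      (fun N => .of_forall fun ω => ?_) (.of_forall fun ω => ?_)
    · rw [Real.norm_of_nonneg (sq_nonneg _)]
      have h1 := pow_le_pow_left₀ (posPart_nonneg _ _)
        (hcon.posPart_le_of_mem (ctrl k ω) (hsX N ω) hz) 2
      rw [mul_pow] at h1
      exact h1.trans (mul_le_mul_of_nonneg_left (hsb2 N ω) (sq_nonneg _))
    · refine Tendsto.pow ?_ 2
      rw [tendsto_iff_dist_tendsto_zero]
      have h0 : Tendsto (fun N => Cg * ‖s N ω - u ω‖) atTop (𝓝 0) := by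
        simpa using (tendsto_iff_norm_sub_tendsto_zero.1 (hst ω)).const_mul Cg
      refine squeeze_zero (fun _ => dist_nonneg) (fun N => ?_) h0
      rw [Real.dist_eq]
      exact hcon.posPart_lipschitz _ (hsX N ω) (hmem ω)

end Regularity

/-! ### Elementary moment and integrability estimates. -/

section Moments

variable {n : ℕ} {Ω Ξ : Type*} [MeasurableSpace Ω] {P : Measure Ω}

theorem integrable_norm_of_memLp_two [IsProbabilityMeasure P] {f : Ω → EuclideanSpace ℝ (Fin n)} (hf : MemLp f 2 P) :
    Integrable (fun ω => ‖f ω‖) P :=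
  (hf.integrable one_le_two).norm

theorem sq_integral_norm_le [IsProbabilityMeasure P] {f : Ω → EuclideanSpace ℝ (Fin n)} (hf : MemLp f 2 P) :
    (∫ ω, ‖f ω‖ ∂P) ^ 2 ≤ ∫ ω, ‖f ω‖ ^ 2 ∂P := by
  have h1 := integrable_norm_of_memLp_two hf
  have h2 : Integrable (fun ω => ‖f ω‖ ^ 2) P := hf.integrable_norm_pow two_ne_zero
  set a := ∫ ω, ‖f ω‖ ∂P with ha
  have h3 : 0 ≤ ∫ ω, (‖f ω‖ ^ 2 - 2 * a * ‖f ω‖ + a ^ 2) ∂P :=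
    integral_nonneg fun ω => by
      have := sq_nonneg (‖f ω‖ - a)
      simp only [Pi.zero_apply]
      linarith
  rw [integral_add (by exact h2.sub (h1.const_mul _)) (integrable_const _),
    integral_sub h2 (h1.const_mul _), integral_const_mul, ← ha] at h3
  simp only [integral_const, probReal_univ, smul_eq_mul, one_mul] at h3
  linarith

variable {v : Ω → Ξ} {F : Ξ → EuclideanSpace ℝ (Fin n) → EuclideanSpace ℝ (Fin n)}
  {x : EuclideanSpace ℝ (Fin n)}

theorem sq_norm_meanOperator_le [IsProbabilityMeasure P] (h : MemLp (fun ω => F (v ω) x) 2 P) :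
    ‖meanOperator P v F x‖ ^ 2 ≤ ∫ ω, ‖F (v ω) x‖ ^ 2 ∂P :=
  (pow_le_pow_left₀ (norm_nonneg _) (norm_integral_le_integral_norm _) 2).trans
    (sq_integral_norm_le h)

theorem norm_meanOperator_le_rootMoment [IsProbabilityMeasure P] (h : MemLp (fun ω => F (v ω) x) 2 P) :
    ‖meanOperator P v F x‖ ≤ rootMoment P v F x :=
  Real.le_sqrt_of_sq_le (sq_norm_meanOperator_le h)

theorem integrable_norm_of_sq [IsProbabilityMeasure P] {u : Ω → EuclideanSpace ℝ (Fin n)} (hu : Measurable u)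
    (h : Integrable (fun ω => ‖u ω‖ ^ 2) P) : Integrable (fun ω => ‖u ω‖) P :=
  ((integrable_const (1 : ℝ)).add h).mono' hu.norm.aestronglyMeasurable <| .of_forall fun ω => by
    rw [norm_norm]
    have := sq_nonneg (‖u ω‖ - 1)
    have := sq_nonneg ‖u ω‖
    simp only [Pi.add_apply]
    linarith

theorem integrable_infDist [IsProbabilityMeasure P] {S : Set (EuclideanSpace ℝ (Fin n))}
    {u : Ω → EuclideanSpace ℝ (Fin n)} (hu : Measurable u)
    {z : EuclideanSpace ℝ (Fin n)} (hz : z ∈ S) (hint : Integrable (fun ω => ‖u ω - z‖ ^ 2) P) :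
    Integrable (fun ω => Metric.infDist (u ω) S) P :=
  (integrable_norm_of_sq (hu.sub_const z) hint).mono' hu.infDist.aestronglyMeasurable <|
    .of_forall fun ω => by
      rw [Real.norm_of_nonneg Metric.infDist_nonneg]
      exact infDist_le_norm hz

theorem integrable_inner_of_sq {p q : Ω → EuclideanSpace ℝ (Fin n)} (hp : Measurable p)
    (hq : Measurable q) (hp2 : Integrable (fun ω => ‖p ω‖ ^ 2) P)
    (hq2 : Integrable (fun ω => ‖q ω‖ ^ 2) P) : Integrable (fun ω => inner ℝ (p ω) (q ω)) P :=
  (hp2.add hq2).mono' (hp.inner hq).aestronglyMeasurable <| .of_forall fun ω => by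
    have h1 := abs_real_inner_le_norm (p ω) (q ω)
    have h2 := two_mul_le_add_sq ‖p ω‖ ‖q ω‖
    have h3 := mul_nonneg (norm_nonneg (p ω)) (norm_nonneg (q ω))
    simp only [Real.norm_eq_abs, Pi.add_apply]
    linarith

end Moments

/-! ### The recurrence for the expected squared distance. -/

/-- The hypotheses shared by both cases, with arbitrary positive stepsizes. -/
structure Setup {n : ℕ} {Ω Ξ ι : Type*} [MeasurableSpace Ω] [MeasurableSpace Ξ]
    [MeasurableSpace ι] (P : Measure Ω) (v : Ω → Ξ)
    (F : Ξ → EuclideanSpace ℝ (Fin n) → EuclideanSpace ℝ (Fin n))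
    (X₀ : Set (EuclideanSpace ℝ (Fin n)))
    (D : ι → Set (EuclideanSpace ℝ (Fin n))) (g : ι → EuclideanSpace ℝ (Fin n) → ℝ)
    (Cg : ℝ) (α : ℕ → ℝ) (β : ℝ) (ctrl : ℕ → Ω → ι) (vs : ℕ → Ω → Ξ)
    (x0 : EuclideanSpace ℝ (Fin n)) (x y d : ℕ → Ω → EuclideanSpace ℝ (Fin n))
    (c ρ τ : ℝ) : Prop where
  measurable_v : Measurable v
  measurable_F : Measurable (Function.uncurry F)
  integrable_F : ∀ x, Integrable (fun ω => F (v ω) x) P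
  model : ConstraintModel X₀ D g Cg
  step_pos : ∀ k, 0 < α k
  relax_pos : 0 < β
  relax_lt_two : β < 2
  measurable_ctrl : ∀ k, Measurable (ctrl k)
  method : IsMethod X₀ D g F ctrl vs α (fun _ => β) x0 x y d
  nonempty : (solutionSet (meanOperator P v F) (feasibleSet X₀ D g)).Nonempty
  monotone : ∀ a b : EuclideanSpace ℝ (Fin n),
    0 ≤ inner ℝ (meanOperator P v F b - meanOperator P v F a) (b - a)
  sample : ∀ k, IsFreshSample (history ctrl vs k) P v (vs k)
  c_pos : 0 < c
  regular : ConstraintRegularity P X₀ D g ctrl vs c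
  rho_pos : 0 < ρ
  sharp : WeakSharp (meanOperator P v F) (feasibleSet X₀ D g) ρ
  continuous : Continuous (meanOperator P v F)
  one_lt_tau : 1 < τ

/-- At most quadratic growth of the second moment of `F(v, ·)` on `X₀`, centred at `z`. -/
structure MomentGrowth {n : ℕ} {Ω Ξ : Type*} [MeasurableSpace Ω] (P : Measure Ω) (v : Ω → Ξ)
    (F : Ξ → EuclideanSpace ℝ (Fin n) → EuclideanSpace ℝ (Fin n))
    (X₀ : Set (EuclideanSpace ℝ (Fin n))) (z : EuclideanSpace ℝ (Fin n)) (a b : ℝ) : Prop where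
  memLp : ∀ x ∈ X₀, MemLp (fun ω => F (v ω) x) 2 P
  bound : ∀ x ∈ X₀, ∫ ω, ‖F (v ω) x‖ ^ 2 ∂P ≤ a * ‖x - z‖ ^ 2 + b

section Recurrence

variable {n : ℕ} {Ω Ξ ι : Type*} [MeasurableSpace Ω] [MeasurableSpace Ξ] [MeasurableSpace ι]
  {P : Measure Ω} {v : Ω → Ξ}
  {F : Ξ → EuclideanSpace ℝ (Fin n) → EuclideanSpace ℝ (Fin n)}
  {X₀ : Set (EuclideanSpace ℝ (Fin n))}
  {D : ι → Set (EuclideanSpace ℝ (Fin n))} {g : ι → EuclideanSpace ℝ (Fin n) → ℝ}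
  {Cg : ℝ} {α : ℕ → ℝ} {β : ℝ} {ctrl : ℕ → Ω → ι} {vs : ℕ → Ω → Ξ}
  {x0 : EuclideanSpace ℝ (Fin n)} {x y d : ℕ → Ω → EuclideanSpace ℝ (Fin n)} {c ρ τ : ℝ}

/-- Weak sharpness speaks only of feasible points, so it is applied at the projection of `u` onto
`X`. Moving back to `u` costs `ρ` in the distance term and `B` in the inner product; monotonicity
then replaces `T z` by `T u`. -/
theorem WeakSharp.drift {T : EuclideanSpace ℝ (Fin n) → EuclideanSpace ℝ (Fin n)}
    {X : Set (EuclideanSpace ℝ (Fin n))} (hs : WeakSharp T X ρ) (hX : IsClosed X) (hρ : 0 < ρ)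
    (hmono : ∀ a b : EuclideanSpace ℝ (Fin n), 0 ≤ inner ℝ (T b - T a) (b - a))
    {z : EuclideanSpace ℝ (Fin n)} (hz : z ∈ solutionSet T X) {B : ℝ} (hB : ‖T z‖ ≤ B)
    (u : EuclideanSpace ℝ (Fin n)) :
    ρ * Metric.infDist u (solutionSet T X) - (ρ + B) * Metric.infDist u X ≤
      inner ℝ (T u) (u - z) := by
  obtain ⟨p, hp⟩ := exists_isProjection hX ⟨z, hz.1⟩ u
  rw [hp.infDist_eq]
  have h1 := hs z hz p hp.1
  have h2 := infDist_le_infDist_add_norm (solutionSet T X) u p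
  have h3 := hmono z u
  have h4 := neg_le_of_abs_le (abs_real_inner_le_norm (T z) (u - p))
  have h5 := mul_le_mul_of_nonneg_right hB (norm_nonneg (u - p))
  have h6 := mul_le_mul_of_nonneg_left h2 hρ.le
  have h7 : inner ℝ (T z) (u - z) = inner ℝ (T z) (p - z) + inner ℝ (T z) (u - p) := by
    rw [← inner_add_right]
    congr 1
    abel
  rw [inner_sub_left] at h3
  linarith

theorem mul_two_sub_le_one (β : ℝ) : β * (2 - β) ≤ 1 := by
  nlinarith [sq_nonneg (β - 1)]

namespace Setup

variable (h : Setup P v F X₀ D g Cg α β ctrl vs x0 x y d c ρ τ)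
include h

theorem history_le (k : ℕ) : history ctrl vs k ≤ ‹MeasurableSpace Ω› :=
  SVI.history_le h.measurable_ctrl (fun k => (h.sample k).measurable) k

theorem measurable_iterate (k : ℕ) : Measurable (x k) :=
  (h.method.measurable_iterate h.model h.measurable_F k).mono (h.history_le k) le_rfl

theorem isClosed_solutionSet :
    IsClosed (solutionSet (meanOperator P v F) (feasibleSet X₀ D g)) :=
  SVI.isClosed_solutionSet h.model.isClosed_feasibleSet h.continuous

theorem convex_solutionSet :
    Convex ℝ (solutionSet (meanOperator P v F) (feasibleSet X₀ D g)) :=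
  SVI.convex_solutionSet h.model.convex_feasibleSet h.continuous h.monotone

theorem constG_pos : 0 < constG c Cg τ := by
  have := h.c_pos
  have := h.model.bound_pos
  have := h.one_lt_tau
  have : 0 < τ - 1 := by linarith
  rw [constG]
  positivity

theorem relax_mul_pos : 0 < β * (2 - β) :=
  mul_pos h.relax_pos (by linarith [h.relax_lt_two])

theorem integrable_sq_sample [IsProbabilityMeasure P] {z : EuclideanSpace ℝ (Fin n)} {a b : ℝ}
    (hg : MomentGrowth P v F X₀ z a b) (k : ℕ)
    {w : Ω → Ξ} (hw : IsFreshSample (history ctrl vs k) P v w) {u : Ω → EuclideanSpace ℝ (Fin n)}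
    (hu : Measurable[history ctrl vs k] u) (hmem : ∀ ω, u ω ∈ X₀)
    (hint : Integrable (fun ω => ‖u ω - z‖ ^ 2) P) :
    Integrable (fun ω => ‖F (w ω) (u ω)‖ ^ 2) P := by
  refine hw.integrable_comp (h.history_le k) h.measurable_v hu (f := fun ξ a => ‖F ξ a‖ ^ 2)
    (h.measurable_F.norm.pow_const 2).stronglyMeasurable h.model.closed_hard.measurableSet hmem
    (fun e he => (hg.memLp e he).integrable_norm_pow two_ne_zero)
    (b := fun e => a * ‖e - z‖ ^ 2 + b) (by fun_prop) (fun e he => ?_)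
    ((hint.const_mul a).add (integrable_const b))
  simpa using hg.bound e he

theorem integral_sq_sample_le [IsProbabilityMeasure P] {z : EuclideanSpace ℝ (Fin n)} {a b : ℝ}
    (hg : MomentGrowth P v F X₀ z a b) (k : ℕ)
    (hint : Integrable (fun ω => ‖x k ω - z‖ ^ 2) P) :
    ∫ ω, ‖F (vs k ω) (x k ω)‖ ^ 2 ∂P ≤ a * (∫ ω, ‖x k ω - z‖ ^ 2 ∂P) + b := by
  have hx := h.method.measurable_iterate h.model h.measurable_F k
  have hi := h.integrable_sq_sample hg k (h.sample k) hx (h.method.mem k) hint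
  rw [(h.sample k).integral_comp_eq (h.history_le k) h.measurable_v hx
    (f := fun ξ a => ‖F ξ a‖ ^ 2) (h.measurable_F.norm.pow_const 2).stronglyMeasurable hi]
  have h1 : ∫ ω, (a * ‖x k ω - z‖ ^ 2 + b) ∂P = a * (∫ ω, ‖x k ω - z‖ ^ 2 ∂P) + b := by
    rw [integral_add (hint.const_mul a) (integrable_const b), integral_const_mul]
    simp
  rw [← h1]
  refine integral_mono_of_nonneg (.of_forall fun ω => integral_nonneg fun _ => sq_nonneg _)
    ((hint.const_mul a).add (integrable_const b)) (.of_forall fun ω => ?_)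
  exact hg.bound _ (h.method.mem k ω)

/-- Integrability is part of the conclusion so that it propagates by induction along the iterates.
-/
theorem expected_step [IsProbabilityMeasure P] {z : EuclideanSpace ℝ (Fin n)}
    (hz : z ∈ solutionSet (meanOperator P v F) (feasibleSet X₀ D g)) {a b B : ℝ}
    (hg : MomentGrowth P v F X₀ z a b) (hB : ‖meanOperator P v F z‖ ≤ B) (k : ℕ)
    (hint : Integrable (fun ω => ‖x k ω - z‖ ^ 2) P) :
    Integrable (fun ω => ‖x (k + 1) ω - z‖ ^ 2) P ∧
    ∫ ω, ‖x (k + 1) ω - z‖ ^ 2 ∂P ≤ ∫ ω, ‖x k ω - z‖ ^ 2 ∂P -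
      2 * α k * ρ * (∫ ω, Metric.infDist (x k ω)
        (solutionSet (meanOperator P v F) (feasibleSet X₀ D g)) ∂P) +
      α k ^ 2 * (τ * (a * (∫ ω, ‖x k ω - z‖ ^ 2 ∂P) + b) +
        constG c Cg τ * (ρ + B) ^ 2 * (β * (2 - β))⁻¹) := by
  set T := meanOperator P v F
  set X := feasibleSet X₀ D g
  set S := solutionSet T X
  have hx := h.method.measurable_iterate h.model h.measurable_F k
  have hxm := h.measurable_iterate k
  have hxm' := h.measurable_iterate (k + 1)
  have hFm : Measurable fun ω => F (vs k ω) (x k ω) :=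
    h.measurable_F.comp ((h.sample k).measurable.prodMk hxm)
  have hF2 := h.integrable_sq_sample hg k (h.sample k) hx (h.method.mem k) hint
  have hF2le := h.integral_sq_sample_le hg k hint
  have hin : Integrable (fun ω => inner ℝ (F (vs k ω) (x k ω)) (x k ω - z)) P :=
    integrable_inner_of_sq hFm (hxm.sub_const z) hF2 hint
  have hinT : Integrable (fun ω => inner ℝ (T (x k ω)) (x k ω - z)) P := by
    refine integrable_inner_of_sq (h.continuous.measurable.comp hxm) (hxm.sub_const z) ?_ hint
    refine ((hint.const_mul a).add (integrable_const b)).mono'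
      ((h.continuous.measurable.comp hxm).norm.pow_const 2).aestronglyMeasurable
      (.of_forall fun ω => ?_)
    rw [Real.norm_of_nonneg (sq_nonneg _)]
    exact (sq_norm_meanOperator_le (hg.memLp _ (h.method.mem k ω))).trans
      (hg.bound _ (h.method.mem k ω))
  -- The sample is independent of the current iterate, so the noisy drift has the mean of the exact
  -- one.
  have hinEq : ∫ ω, inner ℝ (F (vs k ω) (x k ω)) (x k ω - z) ∂P =
      ∫ ω, inner ℝ (T (x k ω)) (x k ω - z) ∂P := by
    rw [(h.sample k).integral_comp_eq (h.history_le k) h.measurable_v hx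
      (f := fun ξ e => inner ℝ (F ξ e) (e - z))
      (h.measurable_F.inner (measurable_snd.sub_const z)).stronglyMeasurable hin]
    refine integral_congr_ae (.of_forall fun ω => ?_)
    simp only [real_inner_comm (x k ω - z)]
    exact integral_inner (h.integrable_F (x k ω)) (x k ω - z)
  set κ := β * (2 - β) * (τ - 1) / (τ * Cg ^ 2) with hκ
  have hτ := h.one_lt_tau
  have hτ1 : 0 < τ - 1 := by linarith
  have hCg := h.model.bound_pos
  have hc := h.c_pos
  have hββ := h.relax_mul_pos
  have hα := h.step_pos k
  have hρ := h.rho_pos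
  have hκ0 : 0 < κ := by positivity
  have hpp : Integrable (fun ω => posPart (g (ctrl k ω)) (x k ω) ^ 2) P :=
    h.model.integrable_posPart_sq (h.measurable_ctrl k) hxm (h.method.mem k) hz.1 hint
  have hpt : ∀ ω, ‖x (k + 1) ω - z‖ ^ 2 ≤ ‖x k ω - z‖ ^ 2 -
      2 * α k * inner ℝ (F (vs k ω) (x k ω)) (x k ω - z) +
      τ * α k ^ 2 * ‖F (vs k ω) (x k ω)‖ ^ 2 - κ * posPart (g (ctrl k ω)) (x k ω) ^ 2 := fun ω =>
    h.model.step_le hα.le h.relax_pos h.relax_lt_two h.one_lt_tau (h.method.mem k ω) hz.1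
      (h.method.operator_step k ω) (h.method.subgradient k ω) (h.method.feasibility_step k ω)
  have hi1 := hin.const_mul (2 * α k)
  have hi2 := hF2.const_mul (τ * α k ^ 2)
  have hi3 := hpp.const_mul κ
  have hi := ((hint.sub hi1).add hi2).sub hi3
  have hint' : Integrable (fun ω => ‖x (k + 1) ω - z‖ ^ 2) P :=
    hi.mono' ((hxm'.sub_const z).norm.pow_const 2).aestronglyMeasurable (.of_forall fun ω => by
      rw [Real.norm_of_nonneg (sq_nonneg _)]
      exact hpt ω)
  refine ⟨hint', ?_⟩
  have h1 := integral_mono hint' hi hpt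
  have h2 : ∫ ω, (((fun ω => ‖x k ω - z‖ ^ 2) -
      (fun ω => 2 * α k * inner ℝ (F (vs k ω) (x k ω)) (x k ω - z)) +
      fun ω => τ * α k ^ 2 * ‖F (vs k ω) (x k ω)‖ ^ 2) -
      fun ω => κ * posPart (g (ctrl k ω)) (x k ω) ^ 2) ω ∂P =
      ∫ ω, ‖x k ω - z‖ ^ 2 ∂P -
      2 * α k * (∫ ω, inner ℝ (F (vs k ω) (x k ω)) (x k ω - z) ∂P) +
      τ * α k ^ 2 * (∫ ω, ‖F (vs k ω) (x k ω)‖ ^ 2 ∂P) -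
      κ * ∫ ω, posPart (g (ctrl k ω)) (x k ω) ^ 2 ∂P := by
    rw [integral_sub' ((hint.sub hi1).add hi2) hi3, integral_add' (hint.sub hi1) hi2,
      integral_sub' hint hi1, integral_const_mul, integral_const_mul, integral_const_mul]
  have h3 := h.regular.integral_le h.model h.measurable_ctrl (fun k => (h.sample k).measurable)
    k hz.1 hx (h.method.mem k) hint
  have hdS := integrable_infDist hxm hz hint
  have hdX := integrable_infDist hxm hz.1 hint
  have hdX2 := integrable_infDist_sq hxm hz.1 hint
  have h4 : ρ * (∫ ω, Metric.infDist (x k ω) S ∂P) -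
      (ρ + B) * (∫ ω, Metric.infDist (x k ω) X ∂P) ≤
      ∫ ω, inner ℝ (T (x k ω)) (x k ω - z) ∂P := by
    rw [← integral_const_mul, ← integral_const_mul,
      ← integral_sub (hdS.const_mul _) (hdX.const_mul _)]
    exact integral_mono ((hdS.const_mul _).sub (hdX.const_mul _)) hinT fun ω =>
      h.sharp.drift h.model.isClosed_feasibleSet hρ h.monotone hz hB (x k ω)
  -- Completing the square pointwise: the infeasibility loss, linear in the distance to `X`, is
  -- absorbed by the quadratic feasibility gain.
  have h5 : 2 * α k * (ρ + B) * (∫ ω, Metric.infDist (x k ω) X ∂P) -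
      κ / c * (∫ ω, Metric.infDist (x k ω) X ^ 2 ∂P) ≤ α k ^ 2 * (ρ + B) ^ 2 / (κ / c) := by
    rw [← integral_const_mul, ← integral_const_mul,
      ← integral_sub (hdX.const_mul _) (hdX2.const_mul _)]
    refine (integral_mono ((hdX.const_mul _).sub (hdX2.const_mul _))
      (integrable_const (α k ^ 2 * (ρ + B) ^ 2 / (κ / c))) fun ω => ?_).trans_eq (by simp)
    have hq : 0 < κ / c := by positivity
    rw [le_div_iff₀ hq, Pi.sub_apply]
    linarith [sq_nonneg (α k * (ρ + B) - κ / c * Metric.infDist (x k ω) X)]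
  have h6 : κ / c * (∫ ω, Metric.infDist (x k ω) X ^ 2 ∂P) ≤
      κ * ∫ ω, posPart (g (ctrl k ω)) (x k ω) ^ 2 ∂P := by
    rw [div_mul_eq_mul_div, div_le_iff₀ hc]
    have := mul_le_mul_of_nonneg_left h3 hκ0.le
    linarith
  have h7 : α k ^ 2 * (ρ + B) ^ 2 / (κ / c) =
      α k ^ 2 * (constG c Cg τ * (ρ + B) ^ 2 * (β * (2 - β))⁻¹) := by
    have : 0 < 2 - β := by linarith [h.relax_lt_two]
    have := h.relax_pos
    rw [hκ, constG]
    field_simp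
  have h8 := mul_le_mul_of_nonneg_left h4 (by positivity : 0 ≤ 2 * α k)
  have h9 := mul_le_mul_of_nonneg_left hF2le (by positivity : 0 ≤ τ * α k ^ 2)
  have h1' := h1.trans_eq h2
  rw [hinEq] at h1'
  rw [h7] at h5
  linarith

theorem integrable_sq [IsProbabilityMeasure P] {z : EuclideanSpace ℝ (Fin n)}
    (hz : z ∈ solutionSet (meanOperator P v F) (feasibleSet X₀ D g)) {a b : ℝ}
    (hg : MomentGrowth P v F X₀ z a b) (k : ℕ) :
    Integrable (fun ω => ‖x k ω - z‖ ^ 2) P := by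
  induction k with
  | zero => simp only [h.method.init, integrable_const]
  | succ k ih => exact (h.expected_step hz hg le_rfl k ih).1

/-- Telescoping of `expected_step`; `J` is a uniform bound on the coefficients of `α_k²`. -/
theorem sum_le [IsProbabilityMeasure P] {z : EuclideanSpace ℝ (Fin n)}
    (hz : z ∈ solutionSet (meanOperator P v F) (feasibleSet X₀ D g)) {a b B J : ℝ}
    (hg : MomentGrowth P v F X₀ z a b) (hB : ‖meanOperator P v F z‖ ≤ B)
    (hJ : ∀ k, τ * (a * (∫ ω, ‖x k ω - z‖ ^ 2 ∂P) + b) +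
      constG c Cg τ * (ρ + B) ^ 2 * (β * (2 - β))⁻¹ ≤ J) (N : ℕ) :
    ∫ ω, ‖x N ω - z‖ ^ 2 ∂P + 2 * ρ * ∑ i ∈ Finset.range N, α i *
      (∫ ω, Metric.infDist (x i ω)
        (solutionSet (meanOperator P v F) (feasibleSet X₀ D g)) ∂P) ≤
      ‖x0 - z‖ ^ 2 + J * ∑ i ∈ Finset.range N, α i ^ 2 := by
  induction N with
  | zero => simp [h.method.init]
  | succ k ih =>
    have h1 := (h.expected_step hz hg hB k (h.integrable_sq hz hg k)).2
    have h2 := mul_le_mul_of_nonneg_left (hJ k) (sq_nonneg (α k))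
    rw [Finset.sum_range_succ, Finset.sum_range_succ]
    linarith

end Setup

end Recurrence

/-! ### Ergodic averages and finite identification. -/

section Ergodic

variable {n : ℕ} {Ω Ξ ι : Type*} [MeasurableSpace Ω] [MeasurableSpace Ξ] [MeasurableSpace ι]
  {P : Measure Ω} {v : Ω → Ξ}
  {F : Ξ → EuclideanSpace ℝ (Fin n) → EuclideanSpace ℝ (Fin n)}
  {X₀ : Set (EuclideanSpace ℝ (Fin n))}
  {D : ι → Set (EuclideanSpace ℝ (Fin n))} {g : ι → EuclideanSpace ℝ (Fin n) → ℝ}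
  {Cg : ℝ} {α : ℕ → ℝ} {β : ℝ} {ctrl : ℕ → Ω → ι} {vs : ℕ → Ω → Ξ}
  {x0 : EuclideanSpace ℝ (Fin n)} {x y d : ℕ → Ω → EuclideanSpace ℝ (Fin n)} {c ρ τ : ℝ}

namespace Setup

section Average

variable (h : Setup P v F X₀ D g Cg α β ctrl vs x0 x y d c ρ τ)
include h

theorem sum_step_pos (k : ℕ) : 0 < ∑ i ∈ Finset.range (k + 1), α i :=
  Finset.sum_pos (fun i _ => h.step_pos i) Finset.nonempty_range_add_one

/-- The average includes `x^k`, which depends only on samples and controls of index below `k`; a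
sample independent of the history at time `k` is therefore fresh for it. -/
theorem measurable_ergodicAverage (k : ℕ) :
    Measurable[history ctrl vs k] (ergodicAverage α x k) := by
  have hx := h.method.measurable_iterate h.model h.measurable_F
  let _ : MeasurableSpace Ω := history ctrl vs k
  suffices Measurable fun ω => ∑ i ∈ Finset.range (k + 1), α i • x i ω from
    this.const_smul (∑ i ∈ Finset.range (k + 1), α i)⁻¹
  refine Finset.measurable_fun_sum _ fun i hi => ?_
  refine Measurable.const_smul ?_ (α i)
  exact (hx i).mono
    (history_mono (Nat.lt_succ_iff.1 (Finset.mem_range.1 hi))) le_rfl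

theorem ergodicAverage_mem (k : ℕ) (ω : Ω) : ergodicAverage α x k ω ∈ X₀ := by
  have := h.model.convex_hard.centerMass_mem (t := Finset.range (k + 1)) (w := α)
    (z := fun i => x i ω) (fun i _ => (h.step_pos i).le) (h.sum_step_pos k)
    fun i _ => h.method.mem i ω
  simpa [Finset.centerMass, ergodicAverage] using this

theorem ergodicAverage_sub (k : ℕ) (ω : Ω) (z : EuclideanSpace ℝ (Fin n)) :
    ergodicAverage α x k ω - z = (∑ i ∈ Finset.range (k + 1), α i)⁻¹ •
      ∑ i ∈ Finset.range (k + 1), α i • (x i ω - z) := by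
  simp only [smul_sub, Finset.sum_sub_distrib, ← Finset.sum_smul, ergodicAverage, smul_smul]
  rw [inv_mul_cancel₀ (h.sum_step_pos k).ne', one_smul]

theorem integrable_sq_ergodicAverage [IsProbabilityMeasure P] {z : EuclideanSpace ℝ (Fin n)}
    (hz : z ∈ solutionSet (meanOperator P v F) (feasibleSet X₀ D g)) {a b : ℝ}
    (hg : MomentGrowth P v F X₀ z a b) (k : ℕ) :
    Integrable (fun ω => ‖ergodicAverage α x k ω - z‖ ^ 2) P := by
  simp only [h.ergodicAverage_sub k]
  have h1 : ∀ i, MemLp (fun ω => x i ω - z) 2 P := fun i =>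
    (memLp_two_iff_integrable_sq_norm
      ((h.measurable_iterate i).sub_const z).aestronglyMeasurable).2 (h.integrable_sq hz hg i)
  have h2 : MemLp (fun ω => ∑ i ∈ Finset.range (k + 1), α i • (x i ω - z)) 2 P :=
    memLp_finsetSum _ fun i _ => (h1 i).const_smul (α i)
  exact (h2.const_smul (∑ i ∈ Finset.range (k + 1), α i)⁻¹).integrable_norm_pow two_ne_zero

/-- Finite identification: if the expected distance of `u` to the solution set is small, then
the auxiliary linear program at `u` is solved by solutions only. -/
theorem linearArgmin_subset [IsProbabilityMeasure P] {z : EuclideanSpace ℝ (Fin n)}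
    (hz : z ∈ solutionSet (meanOperator P v F) (feasibleSet X₀ D g)) {a b : ℝ}
    (hg : MomentGrowth P v F X₀ z a b) {L δ : ℝ≥0} (hδ : 0 < δ) (hδ1 : δ ≤ 1)
    (hT : HolderWith L δ (meanOperator P v F)) {k : ℕ} {w : Ω → Ξ}
    (hw : IsFreshSample (history ctrl vs k) P v w) {u : Ω → EuclideanSpace ℝ (Fin n)}
    (hu : Measurable[history ctrl vs k] u) (hmem : ∀ ω, u ω ∈ X₀)
    (hint : Integrable (fun ω => ‖u ω - z‖ ^ 2) P)
    (hlt : L * (∫ ω, Metric.infDist (u ω)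
      (solutionSet (meanOperator P v F) (feasibleSet X₀ D g)) ∂P) ^ (δ : ℝ) < ρ) :
    Integrable (fun ω => F (w ω) (u ω)) P ∧
      linearArgmin (∫ ω, F (w ω) (u ω) ∂P) (feasibleSet X₀ D g) ⊆
        solutionSet (meanOperator P v F) (feasibleSet X₀ D g) := by
  have hcl := h.isClosed_solutionSet
  have hcv := h.convex_solutionSet
  set T := meanOperator P v F
  set X := feasibleSet X₀ D g
  set S := solutionSet T X
  have hu' : Measurable u := hu.mono (h.history_le k) le_rfl
  have hFm : Measurable fun ω => F (w ω) (u ω) := h.measurable_F.comp (hw.measurable.prodMk hu')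
  have hFi : Integrable (fun ω => F (w ω) (u ω)) P :=
    (integrable_norm_iff hFm.aestronglyMeasurable).1
      (integrable_norm_of_sq hFm (h.integrable_sq_sample hg k hw hu hmem hint))
  refine ⟨hFi, fun e he => ?_⟩
  have hq : ∫ ω, F (w ω) (u ω) ∂P = ∫ ω, T (u ω) ∂P :=
    hw.integral_comp_eq (h.history_le k) h.measurable_v hu h.measurable_F.stronglyMeasurable hFi
  have hTu : Measurable fun ω => T (u ω) := h.continuous.measurable.comp hu'
  have hTui : Integrable (fun ω => T (u ω)) P := by
    refine (integrable_norm_iff hTu.aestronglyMeasurable).1 (integrable_norm_of_sq hTu ?_)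
    refine ((hint.const_mul a).add (integrable_const b)).mono'
      (hTu.norm.pow_const 2).aestronglyMeasurable (.of_forall fun ω => ?_)
    rw [Real.norm_of_nonneg (sq_nonneg _)]
    exact (sq_norm_meanOperator_le (hg.memLp _ (hmem ω))).trans (hg.bound _ (hmem ω))
  have hp : ∀ e, IsProjection S e (proj S e) := isProjection_proj hcl ⟨z, hz⟩
  have hTp : Measurable fun ω => T (proj S (u ω)) :=
    (h.continuous.comp (continuous_proj hcl hcv ⟨z, hz⟩)).measurable.comp hu'
  have hdi := integrable_infDist hu' hz hint
  have hδ' : (0 : ℝ) < δ := hδ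
  have hδi : Integrable (fun ω => Metric.infDist (u ω) S ^ (δ : ℝ)) P := by
    refine ((integrable_const (1 : ℝ)).add hdi).mono'
      (hu'.infDist.pow_const _).aestronglyMeasurable (.of_forall fun ω => ?_)
    have h0 : 0 ≤ Metric.infDist (u ω) S := Metric.infDist_nonneg
    rw [Real.norm_of_nonneg (Real.rpow_nonneg h0 _), Pi.add_apply]
    rcases le_total (Metric.infDist (u ω) S) 1 with h1 | h1
    · linarith [Real.rpow_le_one h0 h1 hδ'.le]
    · linarith [Real.rpow_le_self_of_one_le h1 (show (δ : ℝ) ≤ 1 from hδ1)]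
  have hdiff : ∀ ω, ‖T (u ω) - T (proj S (u ω))‖ ≤ L * Metric.infDist (u ω) S ^ (δ : ℝ) :=
    fun ω => by
      rw [(hp (u ω)).infDist_eq, ← dist_eq_norm, ← dist_eq_norm]
      exact hT.dist_le _ _
  have hTdi : Integrable (fun ω => T (u ω) - T (proj S (u ω))) P :=
    (hδi.const_mul (L : ℝ)).mono' (hTu.sub hTp).aestronglyMeasurable (.of_forall hdiff)
  have hTpi : Integrable (fun ω => T (proj S (u ω))) P :=
    (hTui.sub hTdi).congr (.of_forall fun ω => sub_sub_cancel _ _)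
  -- Jensen's inequality for `t ↦ t^δ`, concave because `δ ≤ 1`.
  have hjensen : ∫ ω, Metric.infDist (u ω) S ^ (δ : ℝ) ∂P ≤
      (∫ ω, Metric.infDist (u ω) S ∂P) ^ (δ : ℝ) :=
    (Real.concaveOn_rpow hδ'.le hδ1).le_map_integral
      (Real.continuous_rpow_const hδ'.le).continuousOn isClosed_Ici
      (.of_forall fun ω => Metric.infDist_nonneg) hdi hδi
  have hclose : ‖∫ ω, T (u ω) ∂P - ∫ ω, T (proj S (u ω)) ∂P‖ < ρ := by
    rw [← integral_sub hTui hTpi]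
    refine lt_of_le_of_lt ?_ hlt
    refine (norm_integral_le_of_norm_le (hδi.const_mul (L : ℝ)) (.of_forall hdiff)).trans ?_
    rw [integral_const_mul]
    exact mul_le_mul_of_nonneg_left hjensen L.coe_nonneg
  by_contra hne
  set e' := proj S e
  have he' : e' ∈ S := (hp e).1
  have hpos : 0 < ‖e - e'‖ := norm_pos_iff.2 (sub_ne_zero.2 fun heq => hne (heq ▸ he'))
  have h1 : inner ℝ (∫ ω, T (u ω) ∂P) (e - e') ≤ 0 := by
    have := he.2 he'.1
    simp only [Set.mem_ofPred_eq, hq] at this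
    rw [inner_sub_right]
    linarith
  -- For each solution `p`, split `e - e' = (e - p) + (p - e')`. Weak sharpness at `p` bounds the
  -- first part; monotonicity and the variational inequality at `e'` make the second nonnegative.
  -- The bound does not depend on `p`, so it can be averaged.
  have h2 : ρ * ‖e - e'‖ ≤ inner ℝ (∫ ω, T (proj S (u ω)) ∂P) (e - e') := by
    rw [real_inner_comm, ← integral_inner hTpi]
    have hc : ρ * ‖e - e'‖ = ∫ _ : Ω, ρ * ‖e - e'‖ ∂P := by simp
    rw [hc]
    refine integral_mono (integrable_const _) (hTpi.const_inner _) fun ω => ?_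
    set p := proj S (u ω)
    have hpS : p ∈ S := (hp (u ω)).1
    have h3 := h.sharp p hpS e he.1
    rw [(hp e).infDist_eq] at h3
    have h4 := h.monotone e' p
    have h5 := he'.2 p hpS.1
    change 0 ≤ inner ℝ (T p - T e') (p - e') at h4
    change ρ * ‖e - e'‖ ≤ inner ℝ (T p) (e - p) at h3
    change _ ≤ inner ℝ (e - e') (T p)
    have h6 : inner ℝ (e - e') (T p) = inner ℝ (T p) (e - p) + inner ℝ (T p) (p - e') := by
      rw [real_inner_comm, ← inner_add_right]
      congr 1
      abel
    rw [inner_sub_left] at h4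
    linarith
  have h7 := neg_le_of_abs_le (abs_real_inner_le_norm
    (∫ ω, T (u ω) ∂P - ∫ ω, T (proj S (u ω)) ∂P) (e - e'))
  have h8 := mul_lt_mul_of_pos_right hclose hpos
  rw [inner_sub_left] at h7
  linarith

end Average

variable {θ lam : ℝ}

theorem mul_integral_infDist_ergodicAverage_le [IsProbabilityMeasure P]
    (h : Setup P v F X₀ D g Cg (stepSize θ lam) β ctrl vs x0 x y d c ρ τ) (hθ : 0 < θ)
    (hlam : 0 < lam) {z : EuclideanSpace ℝ (Fin n)}
    (hz : z ∈ solutionSet (meanOperator P v F) (feasibleSet X₀ D g)) {a b B J : ℝ} (hJ0 : 0 ≤ J)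
    (hg : MomentGrowth P v F X₀ z a b) (hB : ‖meanOperator P v F z‖ ≤ B)
    (hJ : ∀ k, τ * (a * (∫ ω, ‖x k ω - z‖ ^ 2 ∂P) + b) +
      constG c Cg τ * (ρ + B) ^ 2 * (β * (2 - β))⁻¹ ≤ J) {k : ℕ} (hk : 2 ≤ k)
    (hk1 : 1 ≤ (k : ℝ) * Real.log k ^ (1 + lam)) :
    ρ * √((k : ℝ) / Real.log k ^ (1 + lam)) *
      (∫ ω, Metric.infDist (ergodicAverage (stepSize θ lam) x k ω)
        (solutionSet (meanOperator P v F) (feasibleSet X₀ D g)) ∂P) ≤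
      max θ θ⁻¹ / 2 * (‖x0 - z‖ ^ 2 + J * constS lam) := by
  have hcl := h.isClosed_solutionSet
  have hcv := h.convex_solutionSet
  set S := solutionSet (meanOperator P v F) (feasibleSet X₀ D g)
  set α := stepSize θ lam
  set R := √((k : ℝ) / Real.log k ^ (1 + lam))
  set A := ∑ i ∈ Finset.range (k + 1), α i
  have hA : 0 < A := h.sum_step_pos k
  have hρ := h.rho_pos
  have hdi : ∀ i, Integrable (fun ω => Metric.infDist (x i ω) S) P := fun i =>
    integrable_infDist (h.measurable_iterate i) hz (h.integrable_sq hz hg i)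
  have h1 := h.sum_le hz hg hB hJ (k + 1)
  have h2 : ∫ ω, Metric.infDist (ergodicAverage α x k ω) S ∂P ≤
      A⁻¹ * ∑ i ∈ Finset.range (k + 1), α i * (∫ ω, Metric.infDist (x i ω) S ∂P) := by
    have h3 : A⁻¹ * ∑ i ∈ Finset.range (k + 1), α i * (∫ ω, Metric.infDist (x i ω) S ∂P) =
        ∫ ω, A⁻¹ * ∑ i ∈ Finset.range (k + 1), α i * Metric.infDist (x i ω) S ∂P := by
      rw [integral_const_mul, integral_finsetSum _ fun i _ => (hdi i).const_mul _]
      simp only [integral_const_mul]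
    rw [h3]
    refine integral_mono_of_nonneg (.of_forall fun ω => Metric.infDist_nonneg)
      ((integrable_finsetSum _ fun i _ => (hdi i).const_mul _).const_mul _)
      (.of_forall fun ω => ?_)
    exact infDist_weighted_sum_le hcl hcv ⟨z, hz⟩ (fun i _ => (h.step_pos i).le) hA
      fun i => x i ω
  set Q := ∫ ω, Metric.infDist (ergodicAverage α x k ω) S ∂P
  have hQ : 0 ≤ Q := integral_nonneg fun ω => Metric.infDist_nonneg
  rw [← div_eq_inv_mul, le_div_iff₀ hA] at h2
  have h4 : 0 ≤ ∫ ω, ‖x (k + 1) ω - z‖ ^ 2 ∂P := integral_nonneg fun ω => sq_nonneg _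
  have h5 := mul_le_mul_of_nonneg_left (sum_stepSize_sq_le (θ := θ) hlam (k + 1)) hJ0
  have h6 := mul_sqrt_le_sum_stepSize hθ hlam hk hk1
  have h7 := mul_le_mul_of_nonneg_left h6 (mul_nonneg hρ.le hQ)
  have h8 := mul_le_mul_of_nonneg_left h2 hρ.le
  -- The final squared distance is dropped. Dividing by `θ` leaves weights `θ⁻¹` and `θ` on the two
  -- terms, which is where `max θ θ⁻¹` comes from.
  have h9 : θ * (ρ * R * Q) ≤ (‖x0 - z‖ ^ 2 + θ ^ 2 * (J * constS lam)) / 2 := by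
    simp only [α] at h1 h8 h7
    linarith
  have hs := constS_pos hlam
  have h10 : ρ * R * Q ≤ (θ⁻¹ * ‖x0 - z‖ ^ 2 + θ * (J * constS lam)) / 2 := by
    have := mul_le_mul_of_nonneg_left h9 (inv_nonneg.2 hθ.le)
    calc ρ * R * Q = θ⁻¹ * (θ * (ρ * R * Q)) := by field_simp
      _ ≤ _ := this
      _ = _ := by field_simp
  have h11 := mul_le_mul_of_nonneg_right (le_max_right θ θ⁻¹) (sq_nonneg ‖x0 - z‖)
  have h12 := mul_le_mul_of_nonneg_right (le_max_left θ θ⁻¹) (mul_nonneg hJ0 hs.le)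
  linarith

theorem auxiliaryProgramSolves [IsProbabilityMeasure P]
    (h : Setup P v F X₀ D g Cg (stepSize θ lam) β ctrl vs x0 x y d c ρ τ)
    {z : EuclideanSpace ℝ (Fin n)}
    (hz : z ∈ solutionSet (meanOperator P v F) (feasibleSet X₀ D g)) {a b : ℝ}
    (hg : MomentGrowth P v F X₀ z a b) {L δ : ℝ≥0} (hδ : 0 < δ) (hδ1 : δ ≤ 1)
    (hT : HolderWith L δ (meanOperator P v F)) {V : ℝ}
    (hV : ∀ k : ℕ, 2 ≤ k → 1 ≤ (k : ℝ) * Real.log k ^ (1 + lam) →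
      ρ * √((k : ℝ) / Real.log k ^ (1 + lam)) *
      (∫ ω, Metric.infDist (ergodicAverage (stepSize θ lam) x k ω)
        (solutionSet (meanOperator P v F) (feasibleSet X₀ D g)) ∂P) ≤ V) :
    AuxiliaryProgramSolves P v F (feasibleSet X₀ D g) ctrl vs (stepSize θ lam) x lam ρ L δ V := by
  intro k hk hk1 hlt w hw
  refine h.linearArgmin_subset hz hg hδ hδ1 hT hw (h.measurable_ergodicAverage k)
    (h.ergodicAverage_mem k) (h.integrable_sq_ergodicAverage hz hg k) ?_
  have hVk := hV k hk hk1
  set Q := ∫ ω, Metric.infDist (ergodicAverage (stepSize θ lam) x k ω)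
    (solutionSet (meanOperator P v F) (feasibleSet X₀ D g)) ∂P
  have hQ : 0 ≤ Q := integral_nonneg fun ω => Metric.infDist_nonneg
  have hρ := h.rho_pos
  have hδ' : (0 : ℝ) < δ := hδ
  have h1 := Real.lt_sqrt_of_sq_lt hlt
  have hR : 0 < √((k : ℝ) / Real.log k ^ (1 + lam)) :=
    Real.sqrt_pos.2 (lt_of_le_of_lt (sq_nonneg _) hlt)
  set R := √((k : ℝ) / Real.log k ^ (1 + lam))
  have hl : 0 ≤ (L : ℝ) ^ (1 / (δ : ℝ)) := Real.rpow_nonneg L.coe_nonneg _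
  have hρδ : 0 < ρ ^ (1 / (δ : ℝ)) := Real.rpow_pos_of_pos hρ _
  rw [Real.rpow_add hρ, Real.rpow_one, div_lt_iff₀ (mul_pos hρ hρδ)] at h1
  have h2 := mul_le_mul_of_nonneg_right hVk hl
  -- The rate `ρ R Q ≤ V` combined with the threshold on `k`; raising to the power `δ` gives the
  -- identification condition `L Q^δ < ρ`.
  have h3 : Q * (L : ℝ) ^ (1 / (δ : ℝ)) < ρ ^ (1 / (δ : ℝ)) := by
    refine lt_of_mul_lt_mul_left (a := R * ρ) ?_ (mul_pos hR hρ).le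
    linarith
  have h4 := Real.rpow_lt_rpow (mul_nonneg hQ hl) h3 hδ'
  rw [Real.mul_rpow hQ hl, ← Real.rpow_mul L.coe_nonneg, ← Real.rpow_mul hρ.le,
    one_div_mul_cancel hδ'.ne', Real.rpow_one, Real.rpow_one] at h4
  rwa [mul_comm]

end Setup

end Ergodic

/-! ### Uniform moment bounds after the burn-in. -/

/-- A bootstrap: as long as earlier terms stay below `I`, the total increase after `k₀` is at most
`ε (p I + q)`, and `hI` says this cannot lift `M` above `I`. -/
theorem bounded_of_recursion {D s : ℕ → ℝ} {p q ε M I : ℝ} {k₀ : ℕ} (hs : ∀ k, 0 ≤ s k)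
    (hp : 0 ≤ p) (hrec : ∀ k, D (k + 1) ≤ D k + s k * (p * D k + q))
    (hM : ∀ k ≤ k₀, D k ≤ M) (hε : ∀ N, ∑ i ∈ Finset.Ico k₀ N, s i ≤ ε)
    (hMI : M ≤ I) (hpq : 0 ≤ p * I + q) (hI : M + ε * (p * I + q) ≤ I) (k : ℕ) : D k ≤ I := by
  induction k using Nat.strong_induction_on with
  | _ k ih =>
    rcases le_or_gt k k₀ with hk | hk
    · exact (hM k hk).trans hMI
    · have h1 : ∀ N, k₀ ≤ N → N ≤ k →
          D N ≤ M + (∑ i ∈ Finset.Ico k₀ N, s i) * (p * I + q) := by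
        intro N hN
        induction N, hN using Nat.le_induction with
        | base => intro _; simpa using hM k₀ le_rfl
        | succ N hN ih' =>
          intro hNk
          rw [Finset.sum_Ico_succ_top hN, add_mul]
          have h2 := mul_le_mul_of_nonneg_left (ih N (by omega)) hp
          have h3 := mul_le_mul_of_nonneg_left (add_le_add_left h2 q) (hs N)
          have h4 := hrec N
          have h5 := ih' (by omega)
          linarith
      have h6 := mul_le_mul_of_nonneg_right (hε k) hpq
      linarith [h1 k hk.le le_rfl]

theorem IsBurnIn.sum_stepSize_sq_le {L θ lam β τ φ : ℝ} {k₀ : ℕ}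
    (h : IsBurnIn L θ lam β τ φ k₀) (hL : 0 < L) (hθ : 0 < θ) (hlam : 0 < lam) (hβ : 0 < β)
    (hβ2 : β < 2) (hτ : 1 < τ) (hφ : 0 < φ) (N : ℕ) :
    ∑ i ∈ Finset.Ico k₀ N, stepSize θ lam i ^ 2 ≤
      β * (2 - β) * φ / (constH τ * L ^ 2) := by
  obtain ⟨hk2, hk⟩ := h.1
  have hb : 0 < 2 - β := by linarith
  have hτ' : 0 < 1 + τ := by linarith
  set a := 2 * (1 + τ) * L ^ 2 * θ ^ 2 / (lam * β * (2 - β) * φ) with ha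
  have ha0 : 0 < a := by positivity
  have hexp : 1 < Real.exp (a ^ (1 / lam)) := Real.one_lt_exp_iff.2 (Real.rpow_pos_of_pos ha0 _)
  have hk3 : 2 < k₀ := by
    have : (2 : ℝ) < k₀ := by linarith
    exact_mod_cast this
  -- The tail starting at `k₀` is controlled by `log (k₀ - 1)`; the `+ 1` in the burn-in condition
  -- compensates for this shift.
  obtain ⟨m, rfl⟩ : ∃ m, k₀ = m + 1 := ⟨k₀ - 1, by omega⟩
  refine (sum_stepSize_sq_tail_le hlam (by omega) N).trans ?_
  have hm : Real.exp (a ^ (1 / lam)) ≤ m := by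
    push_cast at hk
    linarith
  have hlog : a ^ (1 / lam) ≤ Real.log m :=
    (Real.le_log_iff_exp_le (by linarith)).2 hm
  have h1 : a ≤ Real.log m ^ lam := by
    have h2 := Real.rpow_le_rpow (Real.rpow_nonneg ha0.le _) hlog hlam.le
    rwa [← Real.rpow_mul ha0.le, one_div_mul_cancel hlam.ne', Real.rpow_one] at h2
  calc θ ^ 2 * (lam * Real.log m ^ lam)⁻¹ ≤ θ ^ 2 * (lam * a)⁻¹ := by gcongr
    _ = β * (2 - β) * φ / (constH τ * L ^ 2) := by
      rw [ha, constH]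
      field_simp

section Growth

variable {n : ℕ} {Ω Ξ : Type*} [MeasurableSpace Ω] {P : Measure Ω}
  {v : Ω → Ξ} {F : Ξ → EuclideanSpace ℝ (Fin n) → EuclideanSpace ℝ (Fin n)}

theorem BoundedSecondMoment.momentGrowth {X₀ : Set (EuclideanSpace ℝ (Fin n))} {CF : ℝ}
    (h : BoundedSecondMoment P v F X₀ CF) (z : EuclideanSpace ℝ (Fin n)) :
    MomentGrowth P v F X₀ z 0 (2 * CF ^ 2) :=
  ⟨h.memLp, fun x hx => by simpa using h.bound x hx⟩

/-- Compare `F(v, x)` with `F(v, z)` and use `(a + b)² ≤ 2a² + 2b²`. -/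
theorem RandomLipschitz.momentGrowth [MeasurableSpace Ξ] {ℓ : Ξ → ℝ} (h : RandomLipschitz P v F ℓ)
    (X₀ : Set (EuclideanSpace ℝ (Fin n))) (z : EuclideanSpace ℝ (Fin n)) :
    MomentGrowth P v F X₀ z (2 * lipConst P v ℓ ^ 2) (2 * rootMoment P v F z ^ 2) := by
  refine ⟨fun x _ => h.second_moment x, fun x _ => ?_⟩
  have h1 : lipConst P v ℓ ^ 2 = ∫ ω, ℓ (v ω) ^ 2 ∂P :=
    Real.sq_sqrt (integral_nonneg fun ω => sq_nonneg _)
  have h2 : rootMoment P v F z ^ 2 = ∫ ω, ‖F (v ω) z‖ ^ 2 ∂P :=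
    Real.sq_sqrt (integral_nonneg fun ω => sq_nonneg _)
  have h3 : Integrable (fun ω => ℓ (v ω) ^ 2) P := h.memLp.integrable_sq
  have h4 : ∀ x, Integrable (fun ω => ‖F (v ω) x‖ ^ 2) P := fun x =>
    (h.second_moment x).integrable_norm_pow two_ne_zero
  have h5 : ∫ ω, (2 * ‖x - z‖ ^ 2 * ℓ (v ω) ^ 2 + 2 * ‖F (v ω) z‖ ^ 2) ∂P =
      2 * lipConst P v ℓ ^ 2 * ‖x - z‖ ^ 2 + 2 * rootMoment P v F z ^ 2 := by
    rw [integral_add (h3.const_mul _) ((h4 z).const_mul _), integral_const_mul,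
      integral_const_mul, h1, h2]
    ring
  rw [← h5]
  refine integral_mono_ae (h4 x) ((h3.const_mul _).add ((h4 z).const_mul _)) ?_
  filter_upwards [h.lipschitz] with ω hω
  have h6 := norm_le_norm_add_norm_sub' (F (v ω) x) (F (v ω) z)
  have h7 := h6.trans (add_le_add_right (hω z x) _)
  have h8 := pow_le_pow_left₀ (norm_nonneg _) h7 2
  have h9 := sq_nonneg (‖F (v ω) z‖ - ℓ (v ω) * ‖x - z‖)
  linarith

end Growth

section Constants

theorem constI_nonneg {M G H C B L φ : ℝ} (hM : 0 ≤ M) (hG : 0 ≤ G) (hH : 0 ≤ H) (hφ : 0 ≤ φ)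
    (hφ1 : φ < 1) : 0 ≤ constI M G H C B L φ := by
  have : 0 < 1 - φ := by linarith
  rw [constI]
  positivity

theorem maxMoment_nonneg {n : ℕ} {Ω : Type*} [MeasurableSpace Ω] (P : Measure Ω)
    (x : ℕ → Ω → EuclideanSpace ℝ (Fin n)) (k₀ : ℕ) (z : EuclideanSpace ℝ (Fin n)) :
    0 ≤ maxMoment P x k₀ z :=
  (integral_nonneg fun _ => sq_nonneg _).trans
    (Finset.le_sup' (fun k => ∫ ω, ‖x k ω - z‖ ^ 2 ∂P) (Finset.mem_range.2 k₀.succ_pos))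

theorem le_maxMoment {n : ℕ} {Ω : Type*} [MeasurableSpace Ω] (P : Measure Ω)
    (x : ℕ → Ω → EuclideanSpace ℝ (Fin n)) {k k₀ : ℕ} (hk : k ≤ k₀)
    (z : EuclideanSpace ℝ (Fin n)) :
    ∫ ω, ‖x k ω - z‖ ^ 2 ∂P ≤ maxMoment P x k₀ z :=
  Finset.le_sup' (fun k => ∫ ω, ‖x k ω - z‖ ^ 2 ∂P) (Finset.mem_range.2 (Nat.lt_succ_of_le hk))

end Constants

/-! ### The constants and rates of the two cases. -/

namespace Setup

variable {n : ℕ} {Ω Ξ ι : Type*} [MeasurableSpace Ω] [MeasurableSpace Ξ] [MeasurableSpace ι]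
  {P : Measure Ω} {v : Ω → Ξ}
  {F : Ξ → EuclideanSpace ℝ (Fin n) → EuclideanSpace ℝ (Fin n)}
  {X₀ : Set (EuclideanSpace ℝ (Fin n))}
  {D : ι → Set (EuclideanSpace ℝ (Fin n))} {g : ι → EuclideanSpace ℝ (Fin n) → ℝ}
  {Cg β : ℝ} {ctrl : ℕ → Ω → ι} {vs : ℕ → Ω → Ξ}
  {x0 : EuclideanSpace ℝ (Fin n)} {x y d : ℕ → Ω → EuclideanSpace ℝ (Fin n)} {c ρ τ : ℝ}
  {θ lam : ℝ} (h : Setup P v F X₀ D g Cg (stepSize θ lam) β ctrl vs x0 x y d c ρ τ)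
include h

theorem constJhat_pos (CF : ℝ) (hCF : 0 < CF) : 0 < constJhat c Cg τ ρ CF β := by
  have := h.constG_pos
  have := h.relax_mul_pos
  have := h.rho_pos
  have : 0 < constH τ := by rw [constH]; linarith [h.one_lt_tau]
  rw [constJhat]
  positivity

theorem constVhat_pos (hθ : 0 < θ) (hlam : 0 < lam) {CF : ℝ} (hCF : 0 < CF)
    (S : Set (EuclideanSpace ℝ (Fin n))) : 0 < constVhat x0 S c Cg τ ρ CF β θ lam := by
  have := h.constJhat_pos CF hCF
  have := constS_pos hlam
  have : 0 < max θ θ⁻¹ := lt_max_of_lt_left hθ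
  rw [constVhat]
  positivity

theorem mul_integral_infDist_le_constVhat [IsProbabilityMeasure P] (hθ : 0 < θ) (hlam : 0 < lam)
    {CF : ℝ} (hb : BoundedSecondMoment P v F X₀ CF) {k : ℕ} (hk : 2 ≤ k)
    (hk1 : 1 ≤ (k : ℝ) * Real.log k ^ (1 + lam)) :
    ρ * √((k : ℝ) / Real.log k ^ (1 + lam)) *
      (∫ ω, Metric.infDist (ergodicAverage (stepSize θ lam) x k ω)
        (solutionSet (meanOperator P v F) (feasibleSet X₀ D g)) ∂P) ≤
      constVhat x0 (solutionSet (meanOperator P v F) (feasibleSet X₀ D g))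
        c Cg τ ρ CF β θ lam := by
  -- The moment bound is uniform in `z`, so the solution nearest to `x0` can be used; it attains the
  -- distance in `constVhat`.
  obtain ⟨z, hz⟩ := exists_isProjection h.isClosed_solutionSet h.nonempty x0
  rw [constVhat, hz.infDist_eq]
  have hzX : z ∈ X₀ := hz.1.1.1
  refine h.mul_integral_infDist_ergodicAverage_le hθ hlam hz.1 (h.constJhat_pos CF hb.pos).le
    (hb.momentGrowth z) (B := √2 * CF) ?_ (fun k => ?_) hk hk1
  · refine abs_le_of_sq_le_sq' ?_ (mul_nonneg (Real.sqrt_nonneg 2) hb.pos.le) |>.2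
    rw [mul_pow, Real.sq_sqrt zero_le_two]
    exact (sq_norm_meanOperator_le (hb.memLp z hzX)).trans (hb.bound z hzX)
  · rw [constJhat, constH]
    linarith [sq_nonneg CF]

theorem integral_sq_le_constI [IsProbabilityMeasure P] (hθ : 0 < θ) (hlam : 0 < lam)
    {ℓ : Ξ → ℝ} {φ : ℝ} {k₀ : ℕ} (hℓ : RandomLipschitz P v F ℓ) (hφ : 0 < φ) (hφ1 : φ < 1)
    (hk₀ : IsBurnIn (lipConst P v ℓ) θ lam β τ φ k₀) (hL : 0 < lipConst P v ℓ)
    {z : EuclideanSpace ℝ (Fin n)}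
    (hz : z ∈ solutionSet (meanOperator P v F) (feasibleSet X₀ D g)) (k : ℕ) :
    ∫ ω, ‖x k ω - z‖ ^ 2 ∂P ≤ constI (maxMoment P x k₀ z) (constG c Cg τ) (constH τ)
      (ρ + rootMoment P v F z) (rootMoment P v F z) (lipConst P v ℓ) φ := by
  have hM := maxMoment_nonneg P x k₀ z
  have hM' := fun k (hk : k ≤ k₀) => le_maxMoment P x hk z
  have hG := h.constG_pos
  have hτ := h.one_lt_tau
  have hH : 0 < constH τ := by rw [constH]; linarith
  have hI := constI_nonneg (C := ρ + rootMoment P v F z) (B := rootMoment P v F z)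
    (L := lipConst P v ℓ) hM hG.le hH.le hφ.le hφ1
  have hε := hk₀.sum_stepSize_sq_le hL hθ hlam h.relax_pos h.relax_lt_two hτ hφ
  have hg := hℓ.momentGrowth X₀ z
  have hstep := fun k => (h.expected_step hz hg
    (norm_meanOperator_le_rootMoment (hℓ.second_moment z)) k (h.integrable_sq hz hg k)).2
  have hIdef : (1 - φ) * constI (maxMoment P x k₀ z) (constG c Cg τ) (constH τ)
      (ρ + rootMoment P v F z) (rootMoment P v F z) (lipConst P v ℓ) φ =
      maxMoment P x k₀ z + (constG c Cg τ * (constH τ)⁻¹ * (ρ + rootMoment P v F z) ^ 2 *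
        (lipConst P v ℓ ^ 2)⁻¹ + rootMoment P v F z ^ 2 * (lipConst P v ℓ ^ 2)⁻¹) * φ := by
    rw [constI, mul_div_cancel₀ _ (by linarith)]
  set M := maxMoment P x k₀ z
  set G := constG c Cg τ
  set H := constH τ with hHdef
  set B := rootMoment P v F z
  set L := lipConst P v ℓ
  set I := constI M G H (ρ + B) B L φ
  have hγ := h.relax_mul_pos
  have hγ1 := mul_two_sub_le_one β
  set γ := β * (2 - β)
  -- The coefficient `2τ` is enlarged to `H`, so that `p` times the tail bound is `γ φ ≤ φ < 1`;
  -- `constI` is then defined by the relation `(1 - φ) I = M + …` that closes the bootstrap.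
  refine bounded_of_recursion (s := fun k => stepSize θ lam k ^ 2) (p := H * L ^ 2)
    (q := H * B ^ 2 + G * (ρ + B) ^ 2 * γ⁻¹) (k₀ := k₀) (fun k => sq_nonneg _) (by positivity)
    (fun k => ?_) hM' hε ?_ (by positivity) ?_ k
  · refine (hstep k).trans ?_
    have h0 : 0 ≤ ∫ ω, ‖x k ω - z‖ ^ 2 ∂P := integral_nonneg fun ω => sq_nonneg _
    have h1 : 0 ≤ ∫ ω, Metric.infDist (x k ω)
        (solutionSet (meanOperator P v F) (feasibleSet X₀ D g)) ∂P :=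
      integral_nonneg fun ω => Metric.infDist_nonneg
    have h2 : 0 ≤ 2 * stepSize θ lam k * ρ * ∫ ω, Metric.infDist (x k ω)
        (solutionSet (meanOperator P v F) (feasibleSet X₀ D g)) ∂P :=
      mul_nonneg (mul_nonneg (mul_nonneg zero_le_two (h.step_pos k).le) h.rho_pos.le) h1
    have h3 : τ * (2 * L ^ 2 * (∫ ω, ‖x k ω - z‖ ^ 2 ∂P) + 2 * B ^ 2) +
        G * (ρ + B) ^ 2 * γ⁻¹ ≤ H * L ^ 2 * (∫ ω, ‖x k ω - z‖ ^ 2 ∂P) +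
        (H * B ^ 2 + G * (ρ + B) ^ 2 * γ⁻¹) := by
      rw [hHdef, constH]
      have := mul_nonneg (sq_nonneg L) h0
      have := sq_nonneg B
      linarith
    have h4 := mul_le_mul_of_nonneg_left h3 (sq_nonneg (stepSize θ lam k))
    linarith
  · have h1 : 0 ≤ (G * H⁻¹ * (ρ + B) ^ 2 * (L ^ 2)⁻¹ + B ^ 2 * (L ^ 2)⁻¹) * φ := by positivity
    have h2 := mul_nonneg hφ.le hI
    linarith
  · have h1 : γ * φ / (H * L ^ 2) * (H * L ^ 2 * I + (H * B ^ 2 + G * (ρ + B) ^ 2 * γ⁻¹)) =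
        γ * (φ * I) + G * H⁻¹ * (ρ + B) ^ 2 * (L ^ 2)⁻¹ * φ +
          γ * (B ^ 2 * (L ^ 2)⁻¹ * φ) := by
      field_simp
      ring
    have h2 := mul_le_mul_of_nonneg_right hγ1 (mul_nonneg hφ.le hI)
    have h3 : 0 ≤ B ^ 2 * (L ^ 2)⁻¹ * φ := by positivity
    have h4 := mul_le_mul_of_nonneg_right hγ1 h3
    rw [h1]
    linarith

/-- The lower bound is independent of the solution `z`, so the infimum defining `constV` remains
strictly positive. -/
theorem le_constJ {L φ B M : ℝ} (hM : 0 ≤ M) (hφ : 0 < φ) (hφ1 : φ < 1) (hB : 0 ≤ B) :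
    constG c Cg τ * ρ ^ 2 * (β * (2 - β))⁻¹ ≤ constJ M c Cg τ ρ B L φ β := by
  have hG := h.constG_pos
  have hγ := h.relax_mul_pos
  have hρ := h.rho_pos
  have hH : 0 < constH τ := by rw [constH]; linarith [h.one_lt_tau]
  have hI := constI_nonneg (C := ρ + B) (B := B) (L := L) hM hG.le hH.le hφ.le hφ1
  rw [constJ]
  refine le_add_of_nonneg_of_le (by positivity) ?_
  gcongr
  linarith

theorem constV_pos (hθ : 0 < θ) (hlam : 0 < lam) {φ L : ℝ} (hφ : 0 < φ) (hφ1 : φ < 1) (k₀ : ℕ) :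
    0 < constV P v F x x0 (solutionSet (meanOperator P v F) (feasibleSet X₀ D g))
      k₀ c Cg τ ρ L φ β θ lam := by
  have : Nonempty (solutionSet (meanOperator P v F) (feasibleSet X₀ D g)) := h.nonempty.to_subtype
  have hs := constS_pos hlam
  have hG := h.constG_pos
  have hγ := h.relax_mul_pos
  have hρ := h.rho_pos
  have hθ' : 0 < max θ θ⁻¹ := lt_max_of_lt_left hθ
  rw [constV]
  refine mul_pos (by positivity) (lt_of_lt_of_le (b := constG c Cg τ * ρ ^ 2 * (β * (2 - β))⁻¹ *
    constS lam) (by positivity) (le_ciInf fun z => ?_))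
  refine le_add_of_nonneg_of_le (sq_nonneg _) (mul_le_mul_of_nonneg_right ?_ hs.le)
  exact h.le_constJ (maxMoment_nonneg P x k₀ z) hφ hφ1 (Real.sqrt_nonneg _)

theorem mul_integral_infDist_le_constV [IsProbabilityMeasure P] (hθ : 0 < θ) (hlam : 0 < lam)
    {ℓ : Ξ → ℝ} {φ : ℝ} {k₀ : ℕ} (hℓ : RandomLipschitz P v F ℓ) (hφ : 0 < φ) (hφ1 : φ < 1)
    (hk₀ : IsBurnIn (lipConst P v ℓ) θ lam β τ φ k₀) {k : ℕ} (hk : 2 ≤ k)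
    (hk1 : 1 ≤ (k : ℝ) * Real.log k ^ (1 + lam)) :
    ρ * √((k : ℝ) / Real.log k ^ (1 + lam)) *
      (∫ ω, Metric.infDist (ergodicAverage (stepSize θ lam) x k ω)
        (solutionSet (meanOperator P v F) (feasibleSet X₀ D g)) ∂P) ≤
      constV P v F x x0 (solutionSet (meanOperator P v F) (feasibleSet X₀ D g))
        k₀ c Cg τ ρ (lipConst P v ℓ) φ β θ lam := by
  have : Nonempty (solutionSet (meanOperator P v F) (feasibleSet X₀ D g)) := h.nonempty.to_subtype
  have hθ' : 0 < max θ θ⁻¹ := lt_max_of_lt_left hθ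
  rw [constV, ← div_le_iff₀' (by positivity)]
  -- The quantity being bounded does not involve `z`, so a bound for each solution yields one by the
  -- infimum.
  refine le_ciInf fun ⟨z, hz⟩ => ?_
  rw [div_le_iff₀' (by positivity)]
  have hM := maxMoment_nonneg P x k₀ z
  have hB : 0 ≤ rootMoment P v F z := Real.sqrt_nonneg _
  have hJ := h.le_constJ (L := lipConst P v ℓ) hM hφ hφ1 hB
  have hG := h.constG_pos
  have hγ := h.relax_mul_pos
  have hρ := h.rho_pos
  have hH : 0 < constH τ := by rw [constH]; linarith [h.one_lt_tau]
  have hI := constI_nonneg (C := ρ + rootMoment P v F z) (B := rootMoment P v F z)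
    (L := lipConst P v ℓ) hM hG.le hH.le hφ.le hφ1
  refine h.mul_integral_infDist_ergodicAverage_le hθ hlam hz (le_trans (by positivity) hJ)
    (hℓ.momentGrowth X₀ z) (norm_meanOperator_le_rootMoment (hℓ.second_moment z))
    (fun k => ?_) hk hk1
  have h1 : lipConst P v ℓ ^ 2 * (∫ ω, ‖x k ω - z‖ ^ 2 ∂P) ≤ lipConst P v ℓ ^ 2 *
      constI (maxMoment P x k₀ z) (constG c Cg τ) (constH τ)
      (ρ + rootMoment P v F z) (rootMoment P v F z) (lipConst P v ℓ) φ := by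
    -- When the Lipschitz constant vanishes, the moment enters only multiplied by zero, and no
    -- burn-in estimate is needed.
    rcases (Real.sqrt_nonneg (∫ ω, ℓ (v ω) ^ 2 ∂P)).eq_or_lt with h0 | h0
    · rw [show lipConst P v ℓ = 0 from h0.symm]
      simp
    · exact mul_le_mul_of_nonneg_left
        (h.integral_sq_le_constI hθ hlam hℓ hφ hφ1 hk₀ h0 hz k) (sq_nonneg _)
  have h2 := mul_nonneg (sq_nonneg (lipConst P v ℓ)) hI
  have h3 := mul_le_mul_of_nonneg_left h1 (show 0 ≤ 2 * τ by linarith [h.one_lt_tau])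
  rw [constJ]
  set I := constI (maxMoment P x k₀ z) (constG c Cg τ) (constH τ)
      (ρ + rootMoment P v F z) (rootMoment P v F z) (lipConst P v ℓ) φ
  rw [constH]
  linarith [sq_nonneg (rootMoment P v F z)]

end Setup

end SVI

/-! ### The main theorem. -/

theorem corollary3p4 {n : ℕ} {Ω Ξ ι : Type*}
    [MeasurableSpace Ω] [MeasurableSpace Ξ] [MeasurableSpace ι]
    (P : Measure Ω) [IsProbabilityMeasure P]
    -- the random operator and its mean
    (v : Ω → Ξ) (hv : Measurable v)
    (F : Ξ → EuclideanSpace ℝ (Fin n) → EuclideanSpace ℝ (Fin n))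
    (hF : Measurable (Function.uncurry F))
    (hFint : ∀ x, Integrable (fun ω => F (v ω) x) P)
    -- the constraints
    (X₀ : Set (EuclideanSpace ℝ (Fin n)))
    (D : ι → Set (EuclideanSpace ℝ (Fin n))) (g : ι → EuclideanSpace ℝ (Fin n) → ℝ)
    (Cg : ℝ) (hcon : SVI.ConstraintModel X₀ D g Cg)
    -- the method, with the prescribed stepsizes
    (θ lam β : ℝ) (hθ : 0 < θ) (hlam : 0 < lam) (hβ : 0 < β) (hβ2 : β < 2)
    (ctrl : ℕ → Ω → ι) (hctrl : ∀ k, Measurable (ctrl k))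
    (vs : ℕ → Ω → Ξ)
    (x0 : EuclideanSpace ℝ (Fin n)) (x y d : ℕ → Ω → EuclideanSpace ℝ (Fin n))
    (hmethod : SVI.IsMethod X₀ D g F ctrl vs (SVI.stepSize θ lam) (fun _ => β) x0 x y d)
    -- consistency, monotonicity, sampling, regularity and weak sharpness
    (hne : (SVI.solutionSet (SVI.meanOperator P v F) (SVI.feasibleSet X₀ D g)).Nonempty)
    (hmono : ∀ a b : EuclideanSpace ℝ (Fin n),
      0 ≤ inner ℝ (SVI.meanOperator P v F b - SVI.meanOperator P v F a) (b - a))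
    (hsample : ∀ k, SVI.IsFreshSample (SVI.history ctrl vs k) P v (vs k))
    (c : ℝ) (hc : 0 < c) (hreg : SVI.ConstraintRegularity P X₀ D g ctrl vs c)
    (ρ : ℝ) (hρ : 0 < ρ)
    (hsharp : SVI.WeakSharp (SVI.meanOperator P v F) (SVI.feasibleSet X₀ D g) ρ)
    -- Hölder continuity of the mean operator
    (L δ : ℝ≥0) (hδ : 0 < δ) (hδ1 : δ ≤ 1)
    (hholder : HolderWith L δ (SVI.meanOperator P v F))
    (τ : ℝ) (hτ : 1 < τ) :
    -- the unbounded case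
    (∀ (ℓ : Ξ → ℝ) (φ : ℝ) (k₀ : ℕ), δ = 1 → SVI.RandomLipschitz P v F ℓ →
      0 < φ → φ < 1 → SVI.IsBurnIn (SVI.lipConst P v ℓ) θ lam β τ φ k₀ →
      0 < SVI.constV P v F x x0
          (SVI.solutionSet (SVI.meanOperator P v F) (SVI.feasibleSet X₀ D g))
          k₀ c Cg τ ρ (SVI.lipConst P v ℓ) φ β θ lam ∧
      SVI.AuxiliaryProgramSolves P v F (SVI.feasibleSet X₀ D g) ctrl vs (SVI.stepSize θ lam) x
        lam ρ L δ
        (SVI.constV P v F x x0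
          (SVI.solutionSet (SVI.meanOperator P v F) (SVI.feasibleSet X₀ D g))
          k₀ c Cg τ ρ (SVI.lipConst P v ℓ) φ β θ lam)) ∧
    -- the bounded case
    (∀ CF : ℝ, SVI.BoundedSecondMoment P v F X₀ CF →
      0 < SVI.constVhat x0
          (SVI.solutionSet (SVI.meanOperator P v F) (SVI.feasibleSet X₀ D g))
          c Cg τ ρ CF β θ lam ∧
      SVI.AuxiliaryProgramSolves P v F (SVI.feasibleSet X₀ D g) ctrl vs (SVI.stepSize θ lam) x
        lam ρ L δ
        (SVI.constVhat x0
          (SVI.solutionSet (SVI.meanOperator P v F) (SVI.feasibleSet X₀ D g))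
          c Cg τ ρ CF β θ lam)) := by
  have h : SVI.Setup P v F X₀ D g Cg (SVI.stepSize θ lam) β ctrl vs x0 x y d c ρ τ :=
    ⟨hv, hF, hFint, hcon, SVI.stepSize_pos hθ, hβ, hβ2, hctrl, hmethod, hne, hmono, hsample, hc,
      hreg, hρ, hsharp, hholder.continuous hδ, hτ⟩
  obtain ⟨z, hz⟩ := hne
  constructor
  · intro ℓ φ k₀ _ hℓ hφ hφ1 hk₀
    refine ⟨h.constV_pos hθ hlam hφ hφ1 k₀, ?_⟩
    exact h.auxiliaryProgramSolves hz (hℓ.momentGrowth X₀ z) hδ hδ1 hholder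
      fun k hk hk1 => h.mul_integral_infDist_le_constV hθ hlam hℓ hφ hφ1 hk₀ hk hk1
  · intro CF hb
    refine ⟨h.constVhat_pos hθ hlam hb.pos _, ?_⟩
    exact h.auxiliaryProgramSolves hz (hb.momentGrowth z) hδ hδ1 hholder
      fun k hk hk1 => h.mul_integral_infDist_le_constVhat hθ hlam hb hk hk1
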